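/- Let $\mathcal M\subset\mathbb R^d$ be a connected smooth embedded submanifold without boundary of dimension $m$ (for instance a compact one, or $\mathbb R^d$ itself), with Riemannian volume $dx$ and gradient $\nabla$. For a continuous $\varrho\ge 0$ on $\mathcal M$ with $\int\varrho\,dx=1$ write $\langle u,v\rangle_\varrho=\int_{\mathcal M}uv\,\varrho\,dx$, and let $H^1(\mathcal M,\varrho)$ be the completion, in the norm $(\int(|u|^2+|\nabla u|^2)\varrho\,dx)^{1/2}$, of the $C^1$ functions on $\{\varrho>0\}$ for which this norm is finite. Let $\Delta_\varrho=-\frac1\varrho\operatorname{div}(\varrho\nabla\,\cdot)$ be the self-adjoint operator on $L^2(\mathcal M,\varrho)$ defined by $\langle\Delta_\varrho u,v\rangle_\varrho=\int\nabla u\cdot\nabla v\,\varrho\,dx$ for all $v\in H^1(\mathcal M,\varrho)$. We say that $\Delta_\varrho$ has discrete point spectrum if $L^2(\mathcal M,\varrho)$ has an orthonormal basis $u_1,u_2,\dots$ of eigenfunctions whose eigenvalues $\lambda_1\le\lambda_2\le\cdots$ tend to $+\infty$. Let $w_1,\dots,w_N>0$ with $\sum_k w_k=1$, let $\rho_1,\dots,\rho_N\in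 C^1(\mathcal M)$ be probability densities with respect to $dx$, and suppose that $\rho=\sum_k w_k\rho_k>0$ everywhere on $\mathcal M$. Put $d\nu=\rho\,dx$, $w_{\max}=\max_i w_i$, $w_{\min}=\min_i w_i$. Assume that $\Delta_\rho$ and each $\Delta_{\rho_k}$ have discrete point spectrum. Define $$\mathcal S=\max_{i\ne j}\int_{\mathcal M}\frac{\rho_i\rho_j}{\rho}\,dx,\qquad \mathcal C=\max_k\frac14\int_{\{\rho_k>0\}}\Big|\frac{\nabla\rho_k}{\rho_k}-\frac{\nabla\rho}{\rho}\Big|^2\rho_k\,dx\in[0,\infty],$$ $$\Theta=\min_k\ \inf\Big\{\frac{\int|\nabla v|^2\rho_k\,dx}{\langle v,v\rangle_{\rho_k}}:\ 0\ne v\in H^1(\mathcal M,\rho_k),\ \int v\,\rho_k\,dx=0\Big\}$$ (with $\mathcal S=0$ if $N=1$). Let $\sigma\in(0,\pi/4)$ and suppose that $$\mathcal S<\frac{w_{\min}(1-\cos^2\sigma)}{w_{\max}\cos^2(\sigma)\,N^2}.$$ Put $$\tau=4\Big(\sqrt{\frac{\Theta(1-N\mathcal S)}{\mathcal C}}-\frac{\sqrt{N\mathcal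 S}}{1-\mathcal S}\Big)^{-1}+\sqrt{\mathcal S},\qquad \delta^*=\frac{w_{\max}\cos^2(\sigma)\,N^2\,\mathcal S}{w_{\min}(1-\cos^2\sigma)},$$ and suppose that $\tau-\sqrt{\mathcal S}>0$ and $\tau N<1$ (in particular $0<\mathcal C<\infty$). Let $s,t>0$ satisfy $$\frac{t^2\sin^2 s}{N\,w_{\max}}\ \ge\ N\Big(\frac{\tau-\sqrt{\mathcal S}}2\Big)^2+4N^{3/2}\Big(\frac1{\sqrt{1-N\tau}}-1\Big),\qquad s+\sigma<\frac\pi4 .$$ Let $u_1,\dots,u_N$ be the first $N$ orthonormal eigenfunctions of $\Delta_\rho$, belonging to its $N$ smallest eigenvalues counted with multiplicity, and let $F=(u_1,\dots,u_N):\mathcal M\to\mathbb R^N$. Then for every $\delta\in[\delta^*,1)$ the probability measure $F_\sharp\nu$ on $\mathbb R^N$ has an orthogonal cone structure with parameters $\big(\sigma+s,\ \delta+t^2,\ \frac{1-\sin s}{\sqrt{w_{\max}}}\big)$. Here a probability measure $\mu$ on $\mathbb R^N$ has an orthogonal cone structure with parameters $(\alpha,\beta,r)$, where $\alpha\in(0,\pi/4)$,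 $\beta\ge0$ and $r>0$, if there is an orthonormal basis $e_1,\dots,e_N$ of $\mathbb R^N$ such that $$\mu\Big(\bigcup_{j=1}^N\Big\{z\in\mathbb R^N:\ \frac{z\cdot e_j}{|z|}>\cos\alpha,\ |z|>r\Big\}\Big)\ \ge\ 1-\beta .$$ -/

import Mathlib

open MeasureTheory Filter Topology Set
open scoped ContDiff ENNReal

/-! ### Submanifolds of Euclidean space, their volume and tangential calculus -/

/-- `M` is an embedded smooth submanifold (without boundary) of `ℝᵈ`, of dimension `m`: around each
of its points there is a smooth diffeomorphism between open subsets of `ℝᵈ` which straightens `M`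
to an `m`-dimensional linear subspace. -/
def IsEmbeddedSubmanifold {d : ℕ} (m : ℕ) (M : Set (EuclideanSpace ℝ (Fin d))) : Prop :=
  ∀ p ∈ M, ∃ Φ : OpenPartialHomeomorph (EuclideanSpace ℝ (Fin d)) (EuclideanSpace ℝ (Fin d)),
    p ∈ Φ.source ∧ ContDiffOn ℝ ∞ Φ Φ.source ∧ ContDiffOn ℝ ∞ Φ.symm Φ.target ∧
      ∃ K : Submodule ℝ (EuclideanSpace ℝ (Fin d)), Module.finrank ℝ K = m ∧
        ∀ x ∈ Φ.source, (x ∈ M ↔ Φ x ∈ K)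

/-- The Riemannian volume `dx` of an `m`-dimensional submanifold `M` of `ℝᵈ`: the restriction to `M`
of the `m`-dimensional Hausdorff measure, normalised to agree with Lebesgue measure on `ℝᵐ`. -/
noncomputable def volOn {d : ℕ} (m : ℕ) (M : Set (EuclideanSpace ℝ (Fin d))) :
    Measure (EuclideanSpace ℝ (Fin d)) :=
  (μHE[m] : Measure (EuclideanSpace ℝ (Fin d))).restrict M

/-- The tangent space `T_x M`, as a linear subspace of `ℝᵈ`. -/
noncomputable def tangentSpaceOn {d : ℕ} (M : Set (EuclideanSpace ℝ (Fin d)))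
    (x : EuclideanSpace ℝ (Fin d)) : Submodule ℝ (EuclideanSpace ℝ (Fin d)) :=
  Submodule.span ℝ (tangentConeAt ℝ M x)

/-- The gradient `∇u(x) ∈ T_x M ⊆ ℝᵈ` of a function `u` on `M`. `gradientWithin` represents some
derivative of `u` along `M` at `x`; any two such derivatives agree on `T_x M`, so the orthogonal
projection to `T_x M` does not depend on the choice. It depends only on the values of `u` on `M`. -/
noncomputable def gradOn {d : ℕ} (M : Set (EuclideanSpace ℝ (Fin d)))
    (u : EuclideanSpace ℝ (Fin d) → ℝ) (x : EuclideanSpace ℝ (Fin d)) :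
    EuclideanSpace ℝ (Fin d) :=
  (tangentSpaceOn M x).starProjection (gradientWithin u M x)

/-! ### Weighted spaces and the weighted Laplacian -/

/-- The measure `ϱ dx` on `M`. -/
noncomputable def weightedVol {d : ℕ} (m : ℕ) (M : Set (EuclideanSpace ℝ (Fin d)))
    (ϱ : EuclideanSpace ℝ (Fin d) → ℝ) : Measure (EuclideanSpace ℝ (Fin d)) :=
  (volOn m M).withDensity fun x => ENNReal.ofReal (ϱ x)

/-- The space `L²(M, ϱ)`. -/
abbrev WeightedL2 {d : ℕ} (m : ℕ) (M : Set (EuclideanSpace ℝ (Fin d)))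
    (ϱ : EuclideanSpace ℝ (Fin d) → ℝ) : Type :=
  Lp ℝ 2 (weightedVol m M ϱ)

/-- `u` belongs to the weighted Sobolev space `H¹(M, ϱ)` and has weak gradient `G`.
`H¹(M, ϱ)` is the completion, in the norm `(∫ (|u|² + |∇u|²) ϱ dx)^(1/2)`, of the functions of class
`C¹` on the open subset `{ϱ > 0}` of `M` for which this norm is finite: `u` and `G` are the limits
in `L²(ϱ)` of such functions and of their gradients. (As `ϱ` is locally bounded above and below on
`{ϱ > 0}`, this is the space of the `u` whose distributional gradient on `{ϱ > 0}` is a function and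
for which this norm is finite, and `G` is determined by `u` up to `ϱ dx`-null sets.) -/
structure HasWeakGradient {d : ℕ} (m : ℕ) (M : Set (EuclideanSpace ℝ (Fin d)))
    (ϱ : EuclideanSpace ℝ (Fin d) → ℝ) (u : EuclideanSpace ℝ (Fin d) → ℝ)
    (G : EuclideanSpace ℝ (Fin d) → EuclideanSpace ℝ (Fin d)) : Prop where
  memLp : MemLp u 2 (weightedVol m M ϱ)
  memLp_gradient : MemLp G 2 (weightedVol m M ϱ)
  exists_approx : ∃ φ : ℕ → EuclideanSpace ℝ (Fin d) → ℝ,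
    (∀ n, ContDiffOn ℝ 1 (φ n) (M ∩ {x | 0 < ϱ x})) ∧
    Tendsto (fun n => eLpNorm (fun x => φ n x - u x) 2 (weightedVol m M ϱ)) atTop (𝓝 0) ∧
    Tendsto (fun n => eLpNorm (fun x => gradOn M (φ n) x - G x) 2 (weightedVol m M ϱ))
      atTop (𝓝 0)

/-- `u` is in the domain of the operator `Δ_ϱ = -(1/ϱ) div(ϱ ∇ ·)` and `Δ_ϱ u = f`: the self-adjoint
operator on `L²(M, ϱ)` given by `⟨Δ_ϱ u, v⟩_ϱ = ∫ ∇u · ∇v ϱ dx` for all `v ∈ H¹(M, ϱ)`. -/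
def IsWeightedLaplacian {d : ℕ} (m : ℕ) (M : Set (EuclideanSpace ℝ (Fin d)))
    (ϱ : EuclideanSpace ℝ (Fin d) → ℝ) (u f : EuclideanSpace ℝ (Fin d) → ℝ) : Prop :=
  MemLp f 2 (weightedVol m M ϱ) ∧
  ∃ G, HasWeakGradient m M ϱ u G ∧
    ∀ v H, HasWeakGradient m M ϱ v H →
      ∫ x, inner ℝ (G x) (H x) ∂(weightedVol m M ϱ) = ∫ x, f x * v x ∂(weightedVol m M ϱ)

/-- `e` is an orthonormal basis of `L²(M, ϱ)` of eigenfunctions of `Δ_ϱ`, the eigenvalues `lam`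
being listed in nondecreasing order, with multiplicity, and having no finite accumulation point. -/
structure IsEigenbasis {d : ℕ} (m : ℕ) (M : Set (EuclideanSpace ℝ (Fin d)))
    (ϱ : EuclideanSpace ℝ (Fin d) → ℝ) (e : HilbertBasis ℕ ℝ (WeightedL2 m M ϱ))
    (lam : ℕ → ℝ) : Prop where
  eigen : ∀ i, IsWeightedLaplacian m M ϱ (e i) (fun x => lam i * e i x)
  mono : Monotone lam
  tendsto_atTop : Tendsto lam atTop atTop

/-- `Δ_ϱ` has a discrete point spectrum, with an associated orthonormal basis of eigenfunctions. -/
def HasDiscreteSpectrum {d : ℕ} (m : ℕ) (M : Set (EuclideanSpace ℝ (Fin d)))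
    (ϱ : EuclideanSpace ℝ (Fin d) → ℝ) : Prop :=
  ∃ (e : HilbertBasis ℕ ℝ (WeightedL2 m M ϱ)) (lam : ℕ → ℝ), IsEigenbasis m M ϱ e lam

/-- `u 0, …, u (N - 1)` are the first `N` orthonormal eigenfunctions of `Δ_ϱ`, belonging to its `N`
smallest eigenvalues counted with multiplicity (for some choice of the orthonormal basis). -/
def IsFirstEigenfunctions {d N : ℕ} (m : ℕ) (M : Set (EuclideanSpace ℝ (Fin d)))
    (ϱ : EuclideanSpace ℝ (Fin d) → ℝ) (u : Fin N → EuclideanSpace ℝ (Fin d) → ℝ) : Prop :=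
  ∃ (e : HilbertBasis ℕ ℝ (WeightedL2 m M ϱ)) (lam : ℕ → ℝ), IsEigenbasis m M ϱ e lam ∧
    ∀ i : Fin N, u i =ᵐ[weightedVol m M ϱ] e i

/-- The Laplacian embedding `F = (u₁, …, u_N)`. -/
noncomputable def laplacianEmbedding {d N : ℕ} (u : Fin N → EuclideanSpace ℝ (Fin d) → ℝ)
    (x : EuclideanSpace ℝ (Fin d)) : EuclideanSpace ℝ (Fin N) :=
  WithLp.toLp 2 fun i => u i x

/-! ### Mixture models and their parameters -/

/-- The mixture density `ρ = ∑ w_k ρ_k`. -/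
def mixtureDensity {d N : ℕ} (w : Fin N → ℝ) (ρ : Fin N → EuclideanSpace ℝ (Fin d) → ℝ)
    (x : EuclideanSpace ℝ (Fin d)) : ℝ :=
  ∑ k, w k * ρ k x

/-- Positive weights adding to one, and probability densities of class `C¹` on `M` whose mixture is
positive everywhere on `M`. Values outside `M` play no role. -/
structure IsMixtureModel {d N : ℕ} (m : ℕ) (M : Set (EuclideanSpace ℝ (Fin d)))
    (w : Fin N → ℝ) (ρ : Fin N → EuclideanSpace ℝ (Fin d) → ℝ) : Prop where
  weight_pos : ∀ k, 0 < w k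
  weight_sum : ∑ k, w k = 1
  contDiffOn : ∀ k, ContDiffOn ℝ 1 (ρ k) M
  nonneg : ∀ k, ∀ x ∈ M, 0 ≤ ρ k x
  integral_eq_one : ∀ k, ∫ x, ρ k x ∂(volOn m M) = 1
  mixture_pos : ∀ x ∈ M, 0 < mixtureDensity w ρ x

/-- The overlapping parameter `𝒮 = max_{i ≠ j} ∫ ρ_i ρ_j / ρ dx` (zero if `N = 1`). -/
noncomputable def overlap {d N : ℕ} (m : ℕ) (M : Set (EuclideanSpace ℝ (Fin d)))
    (w : Fin N → ℝ) (ρ : Fin N → EuclideanSpace ℝ (Fin d) → ℝ) : ℝ :=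
  ⨆ p : {p : Fin N × Fin N // p.1 ≠ p.2},
    ∫ x, ρ p.1.1 x * ρ p.1.2 x / mixtureDensity w ρ x ∂(volOn m M)

/-- The number `𝒞_k = (1/4) ∫_{ρ_k > 0} |∇ρ_k / ρ_k - ∇ρ / ρ|² ρ_k dx ∈ [0, ∞]`. -/
noncomputable def couplingAt {d N : ℕ} (m : ℕ) (M : Set (EuclideanSpace ℝ (Fin d)))
    (w : Fin N → ℝ) (ρ : Fin N → EuclideanSpace ℝ (Fin d) → ℝ) (k : Fin N) : ℝ≥0∞ :=
  (1 / 4) * ∫⁻ x in {x | 0 < ρ k x},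
    ENNReal.ofReal (‖(ρ k x)⁻¹ • gradOn M (ρ k) x -
      (mixtureDensity w ρ x)⁻¹ • gradOn M (mixtureDensity w ρ) x‖ ^ 2 * ρ k x) ∂(volOn m M)

/-- The coupling parameter `𝒞 = max_k 𝒞_k ∈ [0, ∞]`. -/
noncomputable def coupling {d N : ℕ} (m : ℕ) (M : Set (EuclideanSpace ℝ (Fin d)))
    (w : Fin N → ℝ) (ρ : Fin N → EuclideanSpace ℝ (Fin d) → ℝ) : ℝ≥0∞ :=
  ⨆ k, couplingAt m M w ρ k

/-- For a probability density `ϱ`, the infimum of the Rayleigh quotients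
`∫ |∇v|² ϱ dx / ⟨v, v⟩_ϱ` over the nonzero `v ∈ H¹(M, ϱ)` that are orthogonal to the constants. -/
noncomputable def spectralGap {d : ℕ} (m : ℕ) (M : Set (EuclideanSpace ℝ (Fin d)))
    (ϱ : EuclideanSpace ℝ (Fin d) → ℝ) : ℝ :=
  sInf {R : ℝ | ∃ v G, HasWeakGradient m M ϱ v G ∧ ∫ x, v x ∂(weightedVol m M ϱ) = 0 ∧
    0 < ∫ x, v x ^ 2 ∂(weightedVol m M ϱ) ∧
    R = (∫ x, ‖G x‖ ^ 2 ∂(weightedVol m M ϱ)) / ∫ x, v x ^ 2 ∂(weightedVol m M ϱ)}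

/-- The indivisibility parameter `Θ = min_k Θ_k`. -/
noncomputable def indivisibility {d N : ℕ} (m : ℕ) (M : Set (EuclideanSpace ℝ (Fin d)))
    (ρ : Fin N → EuclideanSpace ℝ (Fin d) → ℝ) : ℝ :=
  ⨅ k, spectralGap m M (ρ k)

/-- The quantity `τ = 4 (√(Θ (1 - N𝒮) / 𝒞) - √(N𝒮) / (1 - 𝒮))⁻¹ + √𝒮`. If `𝒞 = ∞` the first square
root is zero, so that `τ ≤ √𝒮` (when `𝒮 < 1`). If `𝒞 = 0` the first square root should be `∞` and
`τ` should be `√𝒮`; here it is zero and again `τ ≤ √𝒮`. Both cases are therefore ruled out by the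
condition `τ - √𝒮 > 0`, with either convention. -/
noncomputable def tauParam {d N : ℕ} (m : ℕ) (M : Set (EuclideanSpace ℝ (Fin d)))
    (w : Fin N → ℝ) (ρ : Fin N → EuclideanSpace ℝ (Fin d) → ℝ) : ℝ :=
  4 * (√(indivisibility m M ρ * (1 - N * overlap m M w ρ) / (coupling m M w ρ).toReal) -
      √(N * overlap m M w ρ) / (1 - overlap m M w ρ))⁻¹ + √(overlap m M w ρ)

/-- The largest weight. -/
noncomputable def wMax {N : ℕ} (w : Fin N → ℝ) : ℝ := ⨆ i, w i

/-- The smallest weight. -/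
noncomputable def wMin {N : ℕ} (w : Fin N → ℝ) : ℝ := ⨅ i, w i

/-- The quantity `δ* = w_max cos²(σ) N² 𝒮 / (w_min (1 - cos²(σ)))`. -/
noncomputable def deltaStar {d N : ℕ} (m : ℕ) (M : Set (EuclideanSpace ℝ (Fin d)))
    (w : Fin N → ℝ) (ρ : Fin N → EuclideanSpace ℝ (Fin d) → ℝ) (σ : ℝ) : ℝ :=
  wMax w * Real.cos σ ^ 2 * N ^ 2 * overlap m M w ρ / (wMin w * (1 - Real.cos σ ^ 2))

/-! ### Orthogonal cone structures -/

/-- The cone `C(e, σ, r) = {z : z · e / |z| > cos σ, |z| > r}`. -/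
def coneSet {k : ℕ} (e : EuclideanSpace ℝ (Fin k)) (σ r : ℝ) : Set (EuclideanSpace ℝ (Fin k)) :=
  {z | Real.cos σ < inner ℝ z e / ‖z‖ ∧ r < ‖z‖}

/-- The probability measure `μ` on `ℝᵏ` has an orthogonal cone structure with parameters
`(σ, δ, r)`. (For `δ ≥ 1` the lower bound on the mass is void.) -/
structure HasOrthogonalConeStructure {k : ℕ} (μ : Measure (EuclideanSpace ℝ (Fin k)))
    (σ δ r : ℝ) : Prop where
  isProbabilityMeasure : IsProbabilityMeasure μ
  angle_pos : 0 < σ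
  angle_lt : σ < Real.pi / 4
  mass_nonneg : 0 ≤ δ
  radius_pos : 0 < r
  exists_basis : ∃ e : OrthonormalBasis (Fin k) ℝ (EuclideanSpace ℝ (Fin k)),
    ENNReal.ofReal (1 - δ) ≤ μ (⋃ j, coneSet (e j) σ r)

/-!
Write `ν = ρ dx` and `q_k = √(ρ_k / ρ)`. The map `x ↦ (q_1, …, q_N)` is the ideal embedding: its
norm is at least `1 / √w_max`, and it lies close to a coordinate axis wherever the densities `ρ_k`
do not overlap, which by Markov's inequality is the case outside a set of measure `δ*`
(`IsMixtureModel.exists_mul_sum_lt_componentRoot_sq`,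
`IsMixtureModel.integrable_pointOverlap_and_integral_le`). It remains to see that the Laplacian
embedding is close in `L²(ν)` to the ideal embedding, up to a rotation of `ℝᴺ`; a second use of
Markov's inequality and the triangle inequality for angles (`cos_add_lt_inner_div_norm`) then
transfer the cones.

The functions `q_k` are unit vectors of `L²(ν)` whose scalar products are at most `√𝒮`, and the
Dirichlet energy of `q_k` is `𝒞_k`. If `v` is orthogonal in `L²(ν)` to all the functions `q_k²`,
then it has mean zero for every `ρ_k`, so that the Poincaré inequalities of the components, added
up with the weights `w_k`, give `∫ |∇v|² dν ≥ Θ ∫ v² dν`. This bounds the eigenvalue following the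
first `N` from below by `Θ` (`IsMixtureModel.indivisibility_le_eigenvalue`), and so `q_k` is
within `√(𝒞 / Θ)` of the span of the first `N` eigenfunctions
(`IsMixtureModel.norm_componentRoot_sub_le`). The projections of the `q_k` to this span have a
Gram matrix close to the identity; replacing them by the orthogonal factor of a polar
decomposition yields the rotation (`exists_orthonormalBasis_near`).

As `q_k` need not be of class `C¹` where `ρ_k` vanishes, the energy estimate is carried out for
the functions `θ (ρ_k / ρ)`, with `θ` a `C¹` approximation of the square root whose derivative
vanishes at `0` (`IsMixtureModel.smoothSqrt_hasWeakGradient`). For these to be admissible their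
tangential gradients have to be measurable, which follows from the continuity of the tangent
projection (`IsEmbeddedSubmanifold.continuousOn_starProjection`).
-/

/-! ### Tangent spaces and tangential gradients -/

section Geometry

variable {d m : ℕ} {M : Set (EuclideanSpace ℝ (Fin d))}

theorem IsEmbeddedSubmanifold.measurableSet (hM : IsEmbeddedSubmanifold m M) :
    MeasurableSet M := by
  have hloc : ∀ p ∈ M, ∃ U : Set (EuclideanSpace ℝ (Fin d)), U ∈ 𝓝 p ∧ MeasurableSet (M ∩ U) := by
    intro p hpM
    obtain ⟨Φ, hp, -, -, K, -, hK⟩ := hM p hpM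
    refine ⟨Φ.source, Φ.open_source.mem_nhds hp, ?_⟩
    have hM' : M ∩ Φ.source = Φ.source \ (Φ.source ∩ Φ ⁻¹' (K : Set _)ᶜ) := by
      ext x
      simp only [Set.mem_sdiff, mem_inter_iff, mem_preimage, mem_compl_iff, SetLike.mem_coe,
        not_and, not_not]
      exact ⟨fun h => ⟨h.2, fun _ => (hK x h.2).1 h.1⟩, fun h => ⟨(hK x h.1).2 (h.2 h.1), h.1⟩⟩
    rw [hM']
    exact Φ.open_source.measurableSet.diff (Φ.continuousOn.isOpen_inter_preimage Φ.open_source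
      K.closed_of_finiteDimensional.isOpen_compl).measurableSet
  choose! U hU hMU using hloc
  obtain ⟨t, htM, htc, hcov⟩ := TopologicalSpace.countable_cover_nhdsWithin
    (s := M) (f := U) fun p hpM => mem_nhdsWithin_of_mem_nhds (hU p hpM)
  have hM' : M = ⋃ p ∈ t, M ∩ U p := by
    rw [← inter_iUnion₂, inter_eq_left.2 hcov]
  rw [hM']
  exact MeasurableSet.biUnion htc fun p hp => hMU p (htM hp)

/-- A linear subspace is contained in its own tangent cone at each of its points, also after
intersecting it with a neighbourhood. -/
theorem Submodule.subset_tangentConeAt_inter {E : Type*} [NormedAddCommGroup E] [NormedSpace ℝ E]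
    (K : Submodule ℝ E) {U : Set E} {y : E} (hy : y ∈ K) (hU : U ∈ 𝓝 y) :
    (K : Set E) ⊆ tangentConeAt ℝ ((K : Set E) ∩ U) y := by
  rw [tangentConeAt_inter_nhds hU]
  intro v hv
  have : v = (y + v) - y := by abel
  rw [this]
  refine mem_tangentConeAt_of_segment_subset ?_
  exact K.convex.segment_subset hy (K.add_mem hy hv)

theorem Submodule.tangentConeAt_subset {E : Type*} [NormedAddCommGroup E] [NormedSpace ℝ E]
    [FiniteDimensional ℝ E] (K : Submodule ℝ E) {y : E} (hy : y ∈ K) :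
    tangentConeAt ℝ (K : Set E) y ⊆ K := by
  intro v hv
  rcases exists_fun_of_mem_tangentConeAt hv with ⟨ι, l, hl, c, a, _, has, hca⟩
  refine IsClosed.mem_of_frequently_of_tendsto K.closed_of_finiteDimensional ?_ hca
  refine (has.mono fun n hn => K.smul_mem (c n) ?_).frequently
  simpa using K.sub_mem hn hy

/-- In a straightening chart `Φ` the tangent space of `M` is the image of the model subspace `K`
under the derivative of `Φ.symm`, which is injective. -/
theorem tangentSpaceOn_eq_map
    (Φ : OpenPartialHomeomorph (EuclideanSpace ℝ (Fin d)) (EuclideanSpace ℝ (Fin d)))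
    (hΦ : ContDiffOn ℝ ∞ Φ Φ.source) (hΦs : ContDiffOn ℝ ∞ Φ.symm Φ.target)
    (K : Submodule ℝ (EuclideanSpace ℝ (Fin d))) (hK : ∀ x ∈ Φ.source, (x ∈ M ↔ Φ x ∈ K))
    {x : EuclideanSpace ℝ (Fin d)} (hx : x ∈ M) (hxs : x ∈ Φ.source) :
    tangentSpaceOn M x =
      K.map (fderiv ℝ Φ.symm (Φ x) : EuclideanSpace ℝ (Fin d) →ₗ[ℝ] EuclideanSpace ℝ (Fin d)) ∧
    Function.Injective (fderiv ℝ Φ.symm (Φ x)) := by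
  have hxt : Φ x ∈ Φ.target := Φ.map_source hxs
  have hsn : Φ.source ∈ 𝓝 x := Φ.open_source.mem_nhds hxs
  have htn : Φ.target ∈ 𝓝 (Φ x) := Φ.open_target.mem_nhds hxt
  have hA : HasFDerivAt Φ (fderiv ℝ Φ x) x :=
    ((hΦ.contDiffAt hsn).differentiableAt (by simp)).hasFDerivAt
  have hB : HasFDerivAt Φ.symm (fderiv ℝ Φ.symm (Φ x)) (Φ x) :=
    ((hΦs.contDiffAt htn).differentiableAt (by simp)).hasFDerivAt
  set A := fderiv ℝ Φ x
  set B := fderiv ℝ Φ.symm (Φ x)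
  have hBx : HasFDerivAt Φ.symm B (Φ x) := hB
  have hAB : A.comp B = ContinuousLinearMap.id ℝ _ := by
    have h1 : HasFDerivAt (Φ ∘ Φ.symm) (A.comp B) (Φ x) := by
      refine HasFDerivAt.comp (Φ x) ?_ hB
      rw [Φ.left_inv hxs]; exact hA
    have h2 : HasFDerivAt (Φ ∘ Φ.symm) (ContinuousLinearMap.id ℝ _) (Φ x) := by
      refine (hasFDerivAt_id (Φ x)).congr_of_eventuallyEq ?_
      filter_upwards [htn] with y hy
      simp [Φ.right_inv hy]
    exact h1.unique h2
  have hBA : B.comp A = ContinuousLinearMap.id ℝ _ := by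
    have h1 : HasFDerivAt (Φ.symm ∘ Φ) (B.comp A) x := hB.comp x hA
    have h2 : HasFDerivAt (Φ.symm ∘ Φ) (ContinuousLinearMap.id ℝ _) x := by
      refine (hasFDerivAt_id x).congr_of_eventuallyEq ?_
      filter_upwards [hsn] with y hy
      simp [Φ.left_inv hy]
    exact h1.unique h2
  refine ⟨?_, ?_⟩
  · apply le_antisymm
    · refine Submodule.span_le.2 fun v hv => ?_
      rw [← tangentConeAt_inter_nhds hsn] at hv
      have h1 := (hA.hasFDerivWithinAt (s := M ∩ Φ.source)).mapsTo_tangent_cone hv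
      have h2 : A v ∈ tangentConeAt ℝ (K : Set (EuclideanSpace ℝ (Fin d))) (Φ x) := by
        refine tangentConeAt_mono ?_ h1
        rintro _ ⟨y, hy, rfl⟩
        exact (hK y hy.2).1 hy.1
      refine ⟨A v, K.tangentConeAt_subset ((hK x hxs).1 hx) h2, ?_⟩
      exact congrArg (fun T => T v) hBA
    · rintro _ ⟨k, hk, rfl⟩
      refine Submodule.subset_span ?_
      have h1 := (hB.hasFDerivWithinAt (s := (K : Set _) ∩ Φ.target)).mapsTo_tangent_cone
        (K.subset_tangentConeAt_inter ((hK x hxs).1 hx) htn hk)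
      rw [Φ.left_inv hxs] at h1
      refine tangentConeAt_mono ?_ h1
      rintro _ ⟨y, hy, rfl⟩
      rw [hK _ (Φ.map_target hy.2), Φ.right_inv hy.2]
      exact hy.1
  · intro v v' hvv
    have := congrArg A hvv
    have e := fun v => congrArg (fun T => T v) hAB
    simp only [ContinuousLinearMap.comp_apply, ContinuousLinearMap.id_apply] at e
    rwa [e, e] at this

/-- The orthogonal projection to the range of an injective operator `L` is `L (L† L)⁻¹ L†`. -/
theorem starProjection_range_eq {E F : Type*} [NormedAddCommGroup E] [InnerProductSpace ℝ E]
    [FiniteDimensional ℝ E] [NormedAddCommGroup F] [InnerProductSpace ℝ F]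
    [FiniteDimensional ℝ F] [CompleteSpace E] [CompleteSpace F]
    (L : F →L[ℝ] E) (hL : Function.Injective L) :
    IsUnit ((ContinuousLinearMap.adjoint L).comp L) ∧
    (LinearMap.range (L : F →ₗ[ℝ] E)).starProjection =
      L.comp ((Ring.inverse ((ContinuousLinearMap.adjoint L).comp L)).comp
        (ContinuousLinearMap.adjoint L)) := by
  have hu : IsUnit ((ContinuousLinearMap.adjoint L).comp L) := by
    rw [ContinuousLinearMap.isUnit_iff_bijective]
    have hinj : Function.Injective ((ContinuousLinearMap.adjoint L).comp L) := by
      rw [injective_iff_map_eq_zero]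
      intro a ha
      have : inner ℝ (L a) (L a) = (0 : ℝ) := by
        rw [← ContinuousLinearMap.adjoint_inner_left]
        have : (ContinuousLinearMap.adjoint L) (L a) = 0 := ha
        rw [this, inner_zero_left]
      exact (injective_iff_map_eq_zero L).1 hL a (inner_self_eq_zero.1 this)
    exact ⟨hinj, (LinearMap.injective_iff_surjective
      (f := (((ContinuousLinearMap.adjoint L).comp L : F →L[ℝ] F) : F →ₗ[ℝ] F))).1 hinj⟩
  refine ⟨hu, ?_⟩
  ext1 y
  refine (Submodule.eq_starProjection_of_mem_of_inner_eq_zero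
    (LinearMap.mem_range.2 ⟨_, rfl⟩) ?_)
  rintro _ ⟨z, rfl⟩
  have key : (ContinuousLinearMap.adjoint L) (L ((Ring.inverse
      ((ContinuousLinearMap.adjoint L).comp L)) ((ContinuousLinearMap.adjoint L) y))) =
      (ContinuousLinearMap.adjoint L) y := by
    have := Ring.mul_inverse_cancel _ hu
    exact congrArg (fun T : F →L[ℝ] F => T ((ContinuousLinearMap.adjoint L) y)) this
  rw [inner_sub_left]
  simp only [ContinuousLinearMap.coe_coe, ContinuousLinearMap.comp_apply]
  rw [← ContinuousLinearMap.adjoint_inner_left, ← ContinuousLinearMap.adjoint_inner_left, key,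
    sub_self]

/-- The orthogonal projections to the tangent spaces of `M` depend continuously on the point. -/
theorem IsEmbeddedSubmanifold.continuousOn_starProjection (hM : IsEmbeddedSubmanifold m M) :
    ContinuousOn (fun x => (tangentSpaceOn M x).starProjection) M := by
  intro p hp
  obtain ⟨Φ, hps, hΦ, hΦs, K, -, hK⟩ := hM p hp
  let L : EuclideanSpace ℝ (Fin d) → (K →L[ℝ] EuclideanSpace ℝ (Fin d)) := fun x =>
    (fderiv ℝ Φ.symm (Φ x)).comp K.subtypeL
  have hform : ∀ x ∈ M ∩ Φ.source,
      IsUnit ((ContinuousLinearMap.adjoint (L x)).comp (L x)) ∧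
      (tangentSpaceOn M x).starProjection = (L x).comp ((Ring.inverse
        ((ContinuousLinearMap.adjoint (L x)).comp (L x))).comp
          (ContinuousLinearMap.adjoint (L x))) := by
    rintro x ⟨hx, hxs⟩
    obtain ⟨h1, h2⟩ := tangentSpaceOn_eq_map Φ hΦ hΦs K hK hx hxs
    have h3 : tangentSpaceOn M x = LinearMap.range (L x : K →ₗ[ℝ] EuclideanSpace ℝ (Fin d)) := by
      rw [h1]
      ext y
      simp [L]
    obtain ⟨h4, h5⟩ := starProjection_range_eq (L x) (h2.comp Subtype.val_injective)
    refine ⟨h4, ?_⟩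
    rw [← h5]
    simp only [h3]
  have hLc : ContinuousAt L p := by
    have h1 : ContinuousAt (fun y => fderiv ℝ Φ.symm y) (Φ p) :=
      (((hΦs.contDiffAt (Φ.open_target.mem_nhds (Φ.map_source hps)))).fderiv_right
        (m := 0) (by simp)).continuousAt
    have h2 : ContinuousAt (fun x => fderiv ℝ Φ.symm (Φ x)) p :=
      ContinuousAt.comp (f := Φ) h1 (Φ.continuousAt hps)
    exact h2.clm_comp continuousAt_const
  have hadj : ContinuousAt (fun x => ContinuousLinearMap.adjoint (L x)) p :=
    (ContinuousLinearMap.adjoint (𝕜 := ℝ) (E := K)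
      (F := EuclideanSpace ℝ (Fin d))).continuous.continuousAt.comp hLc
  have hinv : ContinuousAt (fun x => Ring.inverse
      ((ContinuousLinearMap.adjoint (L x)).comp (L x))) p := by
    obtain ⟨v, hv⟩ := (hform p ⟨hp, hps⟩).1
    have h1 := NormedRing.inverse_continuousAt (R := K →L[ℝ] K) v
    rw [hv] at h1
    exact ContinuousAt.comp (f := fun x => (ContinuousLinearMap.adjoint (L x)).comp (L x)) h1
      (hadj.clm_comp hLc)
  have hcont := (hLc.clm_comp (hinv.clm_comp hadj)).continuousWithinAt (s := M)
  refine hcont.congr_of_eventuallyEq ?_ (hform p ⟨hp, hps⟩).2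
  filter_upwards [self_mem_nhdsWithin, mem_nhdsWithin_of_mem_nhds
    (Φ.open_source.mem_nhds hps)] with x hx hxs
  exact (hform x ⟨hx, hxs⟩).2

/-- Any derivative along `M` computes the tangential gradient. -/
theorem gradOn_eq_of_hasFDerivWithinAt {f : EuclideanSpace ℝ (Fin d) → ℝ}
    {f' : StrongDual ℝ (EuclideanSpace ℝ (Fin d))} {x : EuclideanSpace ℝ (Fin d)}
    (hf : HasFDerivWithinAt f f' M x) :
    gradOn M f x =
      (tangentSpaceOn M x).starProjection ((InnerProductSpace.toDual ℝ _).symm f') := by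
  unfold gradOn
  rw [← sub_eq_zero, ← map_sub, Submodule.starProjection_apply_eq_zero_iff]
  rw [Submodule.mem_orthogonal']
  intro v hv
  unfold tangentSpaceOn at hv
  induction hv using Submodule.span_induction with
  | mem v hv =>
    have := hf.differentiableWithinAt.hasFDerivWithinAt.unique_on hf hv
    rw [inner_sub_left, InnerProductSpace.toDual_symm_apply, gradientWithin,
      InnerProductSpace.toDual_symm_apply, this, sub_self]
  | zero => simp
  | add a b _ _ ha hb => rw [inner_add_right, ha, hb, add_zero]
  | smul c a _ ha => rw [inner_smul_right, ha, mul_zero]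

/-- The tangential gradient of a `C¹` function is continuous along `M`. -/
theorem IsEmbeddedSubmanifold.continuousOn_gradOn (hM : IsEmbeddedSubmanifold m M)
    {f : EuclideanSpace ℝ (Fin d) → ℝ} (hf : ContDiffOn ℝ 1 f M) :
    ContinuousOn (gradOn M f) M := by
  intro p hp
  obtain ⟨U, hU, -, -, f', hf', hcf'⟩ :=
    (contDiffWithinAt_succ_iff_hasFDerivWithinAt' (n := 0) (by simp)).1 (by simpa using hf p hp)
  rw [insert_eq_of_mem hp] at hU
  have h1 : ContinuousWithinAt
      (fun x => (tangentSpaceOn M x).starProjection ((InnerProductSpace.toDual ℝ _).symm (f' x)))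
      M p :=
    (hM.continuousOn_starProjection p hp).clm_apply
      ((LinearIsometryEquiv.continuous _).continuousAt.comp_continuousWithinAt
        hcf'.continuousWithinAt)
  refine h1.congr_of_eventuallyEq ?_
    (gradOn_eq_of_hasFDerivWithinAt (hf' p (mem_of_mem_nhdsWithin hp hU)))
  filter_upwards [hU] with x hx
  exact gradOn_eq_of_hasFDerivWithinAt (hf' x hx)

theorem gradOn_sum_smul {ι : Type*} (T : Finset ι) {f : ι → EuclideanSpace ℝ (Fin d) → ℝ}
    (a : ι → ℝ) {x : EuclideanSpace ℝ (Fin d)}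
    (hf : ∀ i ∈ T, DifferentiableWithinAt ℝ (f i) M x) :
    gradOn M (fun y => ∑ i ∈ T, a i * f i y) x = ∑ i ∈ T, a i • gradOn M (f i) x := by
  have h : HasFDerivWithinAt (fun y => ∑ i ∈ T, a i * f i y)
      (∑ i ∈ T, a i • fderivWithin ℝ (f i) M x) M x := by
    have := HasFDerivWithinAt.fun_sum (u := T) (A := fun i y => a i * f i y)
      (A' := fun i => a i • fderivWithin ℝ (f i) M x) (s := M) (x := x)
      (fun i hi => ((hf i hi).hasFDerivWithinAt).const_mul (a i))
    exact this
  rw [gradOn_eq_of_hasFDerivWithinAt h]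
  simp [gradOn, gradientWithin]

/-- The tangential gradient of `θ (f / g)`. -/
theorem gradOn_comp_div {f g : EuclideanSpace ℝ (Fin d) → ℝ} {θ : ℝ → ℝ} {θ' : ℝ}
    {x : EuclideanSpace ℝ (Fin d)}
    (hf : DifferentiableWithinAt ℝ f M x) (hg : DifferentiableWithinAt ℝ g M x) (hgx : g x ≠ 0)
    (hθ : HasDerivAt θ θ' (f x / g x)) :
    gradOn M (fun y => θ (f y / g y)) x =
      θ' • ((g x)⁻¹ • gradOn M f x - (f x / g x * (g x)⁻¹) • gradOn M g x) := by
  have hd : HasFDerivWithinAt (fun y => f y / g y)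
      ((g x)⁻¹ • fderivWithin ℝ f M x - (f x / g x * (g x)⁻¹) • fderivWithin ℝ g M x) M x := by
    have h1 : HasFDerivWithinAt (fun y => (g y)⁻¹) (-(g x ^ 2)⁻¹ • fderivWithin ℝ g M x) M x :=
      (hasDerivAt_inv hgx).comp_hasFDerivWithinAt x hg.hasFDerivWithinAt
    have h2 := hf.hasFDerivWithinAt.mul h1
    simp only [div_eq_mul_inv]
    refine h2.congr_fderiv ?_
    ext v
    simp
    field_simp
    ring
  have h := hθ.comp_hasFDerivWithinAt x hd
  have h' : HasFDerivWithinAt (fun y => θ (f y / g y)) _ M x := h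
  rw [gradOn_eq_of_hasFDerivWithinAt h']
  simp [gradOn, gradientWithin]

end Geometry

/-! ### Almost orthonormal families -/

section Hilbert

/-- The Hilbert–Schmidt norm of an operator and of its adjoint, each computed in an arbitrary
orthonormal basis, agree. -/
theorem OrthonormalBasis.sum_norm_sq_map_eq_adjoint {ι E : Type*} [Fintype ι]
    [NormedAddCommGroup E] [InnerProductSpace ℝ E] [FiniteDimensional ℝ E]
    (a c : OrthonormalBasis ι ℝ E) (X : E →ₗ[ℝ] E) :
    ∑ k, ‖X (a k)‖ ^ 2 = ∑ i, ‖LinearMap.adjoint X (c i)‖ ^ 2 := by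
  simp_rw [← c.sum_sq_inner_right (X (a _)), ← a.sum_sq_inner_left (LinearMap.adjoint X (c _))]
  rw [Finset.sum_comm]
  simp_rw [LinearMap.adjoint_inner_left]

theorem OrthonormalBasis.sum_norm_sq_map_eq {ι E : Type*} [Fintype ι]
    [NormedAddCommGroup E] [InnerProductSpace ℝ E] [FiniteDimensional ℝ E]
    (a c : OrthonormalBasis ι ℝ E) (X : E →ₗ[ℝ] E) :
    ∑ k, ‖X (a k)‖ ^ 2 = ∑ i, ‖X (c i)‖ ^ 2 := by
  rw [a.sum_norm_sq_map_eq_adjoint c X, c.sum_norm_sq_map_eq_adjoint c X]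

/-- A family of `N` vectors of `ℝᴺ` whose Gram matrix is close to the identity is close to an
orthonormal basis, namely to the orthogonal factor in the polar decomposition of the operator `T`
which maps the standard basis to the family. In an eigenbasis of `T† T` with eigenvalues `g`, the
two differ by `∑ (√g - 1)² ≤ ∑ (g - 1)²`. -/
theorem exists_orthonormalBasis_near_of_gram {N : ℕ} (A : Fin N → EuclideanSpace ℝ (Fin N)) {c : ℝ}
    (hA : ∀ k l, |inner ℝ (A k) (A l) - (if k = l then 1 else 0)| ≤ c) (hc : N * c < 1) :
    ∃ b : OrthonormalBasis (Fin N) ℝ (EuclideanSpace ℝ (Fin N)),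
      ∑ k, ‖A k - b k‖ ^ 2 ≤ (N * c) ^ 2 := by
  classical
  let E := EuclideanSpace ℝ (Fin N)
  let e : OrthonormalBasis (Fin N) ℝ E := EuclideanSpace.basisFun (Fin N) ℝ
  let T : E →ₗ[ℝ] E := e.toBasis.constr ℝ A
  have hT : ∀ k, T (e k) = A k := fun k => by
    rw [← e.coe_toBasis]
    exact e.toBasis.constr_basis ℝ A k
  let S : E →ₗ[ℝ] E := LinearMap.adjoint T ∘ₗ T
  have hS : S.IsSymmetric := fun x y => by
    simp only [S, LinearMap.comp_apply, LinearMap.adjoint_inner_left, LinearMap.adjoint_inner_right]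
  have hn : Module.finrank ℝ E = N := by simp [E]
  let v := hS.eigenvectorBasis hn
  let g := hS.eigenvalues hn
  have hv : ∀ i, S (v i) = g i • v i := fun i => by
    exact hS.apply_eigenvectorBasis hn i
  have hTT : ∀ i j, inner ℝ (T (v i)) (T (v j)) = if i = j then g j else 0 := fun i j => by
    rw [← LinearMap.adjoint_inner_right]
    change inner ℝ (v i) (S (v j)) = _
    rw [hv, inner_smul_right, orthonormal_iff_ite.1 v.orthonormal i j]
    simp
  have hsum : ∑ i, (g i - 1) ^ 2 ≤ (N * c) ^ 2 := by
    have h1 : ∑ i, (g i - 1) ^ 2 = ∑ i, ‖(S - (LinearMap.id : E →ₗ[ℝ] E)) (v i)‖ ^ 2 := by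
      refine Finset.sum_congr rfl fun i _ => ?_
      rw [LinearMap.sub_apply, hv, LinearMap.id_apply]
      have : g i • v i - v i = (g i - 1) • v i := by rw [sub_smul, one_smul]
      rw [this, norm_smul, v.norm_eq_one, mul_one, Real.norm_eq_abs, sq_abs]
    rw [h1, v.sum_norm_sq_map_eq e]
    have h2 : ∀ k, ‖(S - (LinearMap.id : E →ₗ[ℝ] E)) (e k)‖ ^ 2 ≤ N * c ^ 2 := fun k => by
      rw [← e.sum_sq_inner_right]
      have : ∀ l, inner ℝ (e l) ((S - (LinearMap.id : E →ₗ[ℝ] E)) (e k)) ^ 2 ≤ c ^ 2 := fun l => by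
        refine sq_le_sq' ?_ ?_ <;> have := abs_le.1 (hA l k) <;>
        · rw [LinearMap.sub_apply, LinearMap.id_apply, inner_sub_right,
            orthonormal_iff_ite.1 e.orthonormal l k]
          simp only [S, LinearMap.comp_apply, LinearMap.adjoint_inner_right, hT]
          linarith [this.1, this.2]
      refine (Finset.sum_le_sum fun l _ => this l).trans ?_
      simp
    refine (Finset.sum_le_sum fun k _ => h2 k).trans ?_
    simp
    exact le_of_eq (by ring)
  have hg : ∀ i, 0 < g i := fun i => by
    have hN : (0 : ℝ) ≤ N * c := by
      have := (abs_nonneg _).trans (hA i i)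
      positivity
    have h1 : (g i - 1) ^ 2 ≤ (N * c) ^ 2 :=
      (Finset.single_le_sum (f := fun i => (g i - 1) ^ 2) (fun _ _ => sq_nonneg _)
        (Finset.mem_univ i)).trans hsum
    have h2 := abs_le_of_sq_le_sq h1 hN
    linarith [(abs_le.1 h2).1]
  have hw : Orthonormal ℝ fun i => (√(g i))⁻¹ • T (v i) := by
    rw [orthonormal_iff_ite]
    intro i j
    rw [inner_smul_left, inner_smul_right, hTT]
    split_ifs with hij
    · subst hij
      have := Real.mul_self_sqrt (hg i).le
      have h0 := (Real.sqrt_pos.2 (hg i)).ne'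
      simp only [conj_trivial]
      field_simp
      nlinarith [this]
    · simp
  let w : OrthonormalBasis (Fin N) ℝ E := OrthonormalBasis.mk hw (by
    rw [hw.linearIndependent.span_eq_top_of_card_eq_finrank' (by simp [E])])
  have hwi : ∀ i, w i = (√(g i))⁻¹ • T (v i) := fun i => by simp [w]
  let U : E ≃ₗᵢ[ℝ] E := v.equiv w (Equiv.refl _)
  have hU : ∀ i, U (v i) = w i := fun i => by simp [U]
  refine ⟨e.map U, ?_⟩
  have h1 : ∑ k, ‖A k - e.map U k‖ ^ 2 = ∑ k, ‖(T - U.toLinearEquiv.toLinearMap) (e k)‖ ^ 2 := by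
    refine Finset.sum_congr rfl fun k _ => ?_
    simp [hT]
  rw [h1, e.sum_norm_sq_map_eq v]
  refine (Finset.sum_le_sum fun i _ => ?_).trans hsum
  have h2 : (T - U.toLinearEquiv.toLinearMap) (v i) = (√(g i) - 1) • w i := by
    have h0 := (Real.sqrt_pos.2 (hg i)).ne'
    rw [LinearMap.sub_apply]
    change T (v i) - U (v i) = _
    rw [hU, sub_smul, one_smul, hwi, smul_smul, mul_inv_cancel₀ h0, one_smul]
  rw [h2, norm_smul, w.norm_eq_one, mul_one, Real.norm_eq_abs, sq_abs]
  have h3 := Real.mul_self_sqrt (hg i).le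
  have h4 := Real.sqrt_nonneg (g i)
  have h5 : (g i - 1) ^ 2 = (√(g i) - 1) ^ 2 * (√(g i) + 1) ^ 2 := by
    rw [← mul_pow]; congr 1; nlinarith
  rw [h5]
  exact le_mul_of_one_le_right (sq_nonneg _) (by nlinarith)

variable {ι H : Type*} [Fintype ι] [NormedAddCommGroup H] [InnerProductSpace ℝ H]

theorem Orthonormal.inner_sub_sum_inner_smul {e : ι → H} (he : Orthonormal ℝ e) (x y : H) :
    inner ℝ (x - ∑ i, inner ℝ (e i) x • e i) (y - ∑ i, inner ℝ (e i) y • e i) =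
      inner ℝ x y - ∑ i, inner ℝ (e i) x * inner ℝ (e i) y := by
  classical
  have h : ∀ i, inner ℝ (e i) (y - ∑ i, inner ℝ (e i) y • e i) = 0 := fun i => by
    rw [inner_sub_right, he.inner_right_fintype, sub_self]
  rw [inner_sub_left, sum_inner]
  simp_rw [inner_smul_left, h]
  rw [inner_sub_right, inner_sum]
  simp only [mul_zero, Finset.sum_const_zero, sub_zero, inner_smul_right, real_inner_comm]
  congr 1
  exact Finset.sum_congr rfl fun i _ => by rw [mul_comm]

theorem Orthonormal.norm_sub_sum_smul_sq {e : ι → H} (he : Orthonormal ℝ e) (x : H)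
    (b : ι → ℝ) :
    ‖x - ∑ i, b i • e i‖ ^ 2 =
      ‖x - ∑ i, inner ℝ (e i) x • e i‖ ^ 2 + ∑ i, (inner ℝ (e i) x - b i) ^ 2 := by
  classical
  have h : x - ∑ i, b i • e i = (x - ∑ i, inner ℝ (e i) x • e i) +
      ∑ i, (inner ℝ (e i) x - b i) • e i := by
    simp_rw [sub_smul, Finset.sum_sub_distrib]; abel
  have horth : inner ℝ (x - ∑ i, inner ℝ (e i) x • e i)
      (∑ i, (inner ℝ (e i) x - b i) • e i) = 0 := by
    rw [inner_sum]
    refine Finset.sum_eq_zero fun i _ => ?_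
    rw [inner_smul_right, real_inner_comm (e i) (x - _), inner_sub_right, he.inner_right_fintype,
      sub_self, mul_zero]
  rw [h, norm_add_sq_real, horth]
  rw [← real_inner_self_eq_norm_sq (∑ i, (inner ℝ (e i) x - b i) • e i), he.inner_sum]
  simp [sq]

/-- Nearly orthonormal unit vectors `q` which are close to the span of an orthonormal family `e` of
the same size are close to the image of `e` under a rotation. -/
theorem exists_orthonormalBasis_near {N : ℕ} {e q : Fin N → H} (he : Orthonormal ℝ e)
    {η κ : ℝ} (hκ : 0 ≤ κ) (hq : ∀ k, ‖q k‖ = 1) (hqq : ∀ k l, k ≠ l → |inner ℝ (q k) (q l)| ≤ κ)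
    (hres : ∀ k, ‖q k - ∑ i, inner ℝ (e i) (q k) • e i‖ ^ 2 ≤ η) (hlt : N * (κ + η) < 1) :
    ∃ b : OrthonormalBasis (Fin N) ℝ (EuclideanSpace ℝ (Fin N)),
      ∑ k, ‖q k - ∑ i, b k i • e i‖ ^ 2 ≤ N * η + (N * (κ + η)) ^ 2 := by
  let A : Fin N → EuclideanSpace ℝ (Fin N) := fun k => WithLp.toLp 2 fun i => inner ℝ (e i) (q k)
  obtain ⟨b, hb⟩ := exists_orthonormalBasis_near_of_gram A (c := κ + η) (fun k l => by
    set r : Fin N → H := fun k => q k - ∑ i, inner ℝ (e i) (q k) • e i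
    have h1 : inner ℝ (A k) (A l) = inner ℝ (q k) (q l) - inner ℝ (r k) (r l) := by
      rw [he.inner_sub_sum_inner_smul, sub_sub_cancel]
      simp only [A, PiLp.inner_apply, RCLike.inner_apply, conj_trivial]
      exact Finset.sum_congr rfl fun i _ => mul_comm _ _
    have hr : |inner ℝ (r k) (r l)| ≤ η := by
      refine (abs_real_inner_le_norm _ _).trans ?_
      nlinarith [hres k, hres l, sq_nonneg (‖r k‖ - ‖r l‖)]
    have h2 : |inner ℝ (q k) (q l) - (if k = l then 1 else 0)| ≤ κ := by
      split_ifs with h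
      · subst h; rw [real_inner_self_eq_norm_sq, hq]; simpa using hκ
      · simpa using hqq k l h
    rw [h1, show inner ℝ (q k) (q l) - inner ℝ (r k) (r l) - (if k = l then (1 : ℝ) else 0) =
      (inner ℝ (q k) (q l) - (if k = l then 1 else 0)) - inner ℝ (r k) (r l) by ring]
    exact (abs_sub _ _).trans (add_le_add h2 hr)) hlt
  refine ⟨b, ?_⟩
  have h3 : ∀ k, ‖q k - ∑ i, b k i • e i‖ ^ 2 ≤ η + ‖A k - b k‖ ^ 2 := fun k => by
    rw [he.norm_sub_sum_smul_sq, EuclideanSpace.real_norm_sq_eq]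
    exact add_le_add (hres k) le_rfl
  refine (Finset.sum_le_sum fun k _ => h3 k).trans ?_
  rw [Finset.sum_add_distrib]
  simpa using hb

end Hilbert

/-! ### Perturbation of cones -/

/-- If `q` lies in an open cone of half-angle `σ` and `|f - q| < |q| sin s`, then the angle between
`f` and `q` is less than `s`, so that `f` lies in the cone of half-angle `σ + s`. -/
theorem cos_add_lt_inner_div_norm {E : Type*} [NormedAddCommGroup E] [InnerProductSpace ℝ E]
    {f q b : E} (hb : ‖b‖ = 1) {σ s : ℝ} (hσ : 0 ≤ σ) (hs : 0 ≤ s) (hσs : σ + s < Real.pi / 2)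
    (hq : Real.cos σ * ‖q‖ < inner ℝ q b) (hfq : ‖f - q‖ < ‖q‖ * Real.sin s) :
    Real.cos (σ + s) < inner ℝ f b / ‖f‖ := by
  have hqpos : 0 < ‖q‖ := by
    rcases (norm_nonneg q).eq_or_lt with h | h
    · rw [← h, zero_mul] at hfq; exact absurd hfq (norm_nonneg _).not_gt
    · exact h
  have hf : f ≠ 0 := by
    rintro rfl
    rw [zero_sub, norm_neg] at hfq
    nlinarith [Real.sin_le_one s]
  have hfpos : 0 < ‖f‖ := norm_pos_iff.2 hf
  have hq0 : q ≠ 0 := norm_pos_iff.1 hqpos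
  have hb0 : b ≠ 0 := norm_pos_iff.1 (by rw [hb]; exact one_pos)
  have hpi := Real.pi_pos
  have h1 : InnerProductGeometry.angle q b < σ := by
    by_contra! h
    have := Real.cos_le_cos_of_nonneg_of_le_pi hσ (InnerProductGeometry.angle_le_pi q b) h
    rw [InnerProductGeometry.cos_angle, hb, mul_one, div_le_iff₀ hqpos] at this
    exact absurd hq this.not_gt
  have h2 : InnerProductGeometry.angle f q < s := by
    by_contra! h
    have := Real.cos_le_cos_of_nonneg_of_le_pi hs (InnerProductGeometry.angle_le_pi f q) h
    rw [InnerProductGeometry.cos_angle, div_le_iff₀ (by positivity)] at this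
    have h3 : ‖f - q‖ ^ 2 < (‖q‖ * Real.sin s) ^ 2 := by
      exact pow_lt_pow_left₀ hfq (norm_nonneg _) two_ne_zero
    rw [norm_sub_sq_real] at h3
    have h4 := Real.sin_sq_add_cos_sq s
    nlinarith [sq_nonneg (‖f‖ - ‖q‖ * Real.cos s)]
  have h3 : InnerProductGeometry.angle f b < σ + s := by
    linarith [InnerProductGeometry.angle_le_angle_add_angle f q b]
  have h4 := Real.cos_lt_cos_of_nonneg_of_le_pi (InnerProductGeometry.angle_nonneg f b)
    (by linarith) h3
  rwa [InnerProductGeometry.cos_angle, hb, mul_one] at h4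

/-! ### Smoothing the square root -/

/-- A `C¹` approximation of the square root, with vanishing derivative on `(-∞, 0]`. -/
noncomputable def smoothSqrt (ε r : ℝ) : ℝ := √r - ε * Real.arctan (√r / ε)

theorem abs_smoothSqrt_sub_sqrt_le {ε : ℝ} (hε : 0 < ε) (r : ℝ) :
    |smoothSqrt ε r - √r| ≤ ε * (Real.pi / 2) := by
  rw [smoothSqrt, sub_sub_cancel_left, abs_neg, abs_mul, abs_of_pos hε]
  gcongr
  exact abs_le.2 ⟨(Real.neg_pi_div_two_lt_arctan _).le, (Real.arctan_lt_pi_div_two _).le⟩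

/-- The derivative of `smoothSqrt ε`; the maximum makes the formula continuous on all of `ℝ`. -/
noncomputable def smoothSqrtDeriv (ε r : ℝ) : ℝ := √r / (2 * (ε ^ 2 + max r 0))

theorem continuous_smoothSqrtDeriv {ε : ℝ} (hε : 0 < ε) : Continuous (smoothSqrtDeriv ε) := by
  unfold smoothSqrtDeriv
  refine Continuous.div (by fun_prop) (by fun_prop) fun r => ?_
  positivity

theorem hasDerivAt_smoothSqrt {ε : ℝ} (hε : 0 < ε) (r : ℝ) :
    HasDerivAt (smoothSqrt ε) (smoothSqrtDeriv ε r) r := by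
  have hne : ∀ r : ℝ, r ≠ 0 → HasDerivAt (smoothSqrt ε) (smoothSqrtDeriv ε r) r := by
    intro r hr
    rcases hr.lt_or_gt with h | h
    · have h0 : smoothSqrtDeriv ε r = 0 := by
        rw [smoothSqrtDeriv, Real.sqrt_eq_zero_of_nonpos h.le, zero_div]
      rw [h0]
      refine (hasDerivAt_const r (0 : ℝ)).congr_of_eventuallyEq ?_
      filter_upwards [gt_mem_nhds h] with y hy
      simp [smoothSqrt, Real.sqrt_eq_zero_of_nonpos hy.le]
    · have h1 : HasDerivAt (fun r => √r) (1 / (2 * √r)) r := Real.hasDerivAt_sqrt hr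
      have h2 := h1.sub (((h1.div_const ε).arctan).const_mul ε)
      refine h2.congr_deriv ?_
      have h3 := Real.sq_sqrt h.le
      have h4 := (Real.sqrt_pos.2 h).ne'
      rw [smoothSqrtDeriv, max_eq_left h.le]
      have h5 : ε ^ 2 + r ≠ 0 := by positivity
      have h6 : (1 : ℝ) + (√r / ε) ^ 2 = (ε ^ 2 + r) / ε ^ 2 := by
        rw [div_pow, h3]; field_simp
      rw [h6]
      field_simp
      rw [h3]
      ring
  rcases eq_or_ne r 0 with rfl | hr
  · refine hasDerivAt_of_hasDerivAt_of_ne (fun y hy => hne y hy) ?_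
      (continuous_smoothSqrtDeriv hε).continuousAt
    unfold smoothSqrt
    fun_prop
  · exact hne r hr

theorem contDiff_smoothSqrt {ε : ℝ} (hε : 0 < ε) : ContDiff ℝ 1 (smoothSqrt ε) := by
  rw [contDiff_one_iff_deriv]
  refine ⟨fun r => (hasDerivAt_smoothSqrt hε r).differentiableAt, ?_⟩
  rw [show deriv (smoothSqrt ε) = smoothSqrtDeriv ε from
    funext fun r => (hasDerivAt_smoothSqrt hε r).deriv]
  exact continuous_smoothSqrtDeriv hε

theorem smoothSqrtDeriv_zero (ε : ℝ) : smoothSqrtDeriv ε 0 = 0 := by simp [smoothSqrtDeriv]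

theorem smoothSqrtDeriv_sq_mul_le {ε r : ℝ} (hε : 0 < ε) (hr : 0 ≤ r) :
    smoothSqrtDeriv ε r ^ 2 * r ≤ 1 / 4 := by
  rw [smoothSqrtDeriv, max_eq_left hr, div_pow, Real.sq_sqrt hr, div_mul_eq_mul_div,
    div_le_div_iff₀ (by positivity) (by norm_num)]
  nlinarith [sq_nonneg ε, mul_nonneg hr (sq_nonneg ε), sq_nonneg (ε ^ 2)]

/-! ### Weighted measures and weak gradients -/

section WeightedMeasure

variable {d m N : ℕ} {M : Set (EuclideanSpace ℝ (Fin d))}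

theorem ae_mem_weightedVol (hM : MeasurableSet M) (ϱ : EuclideanSpace ℝ (Fin d) → ℝ) :
    ∀ᵐ x ∂weightedVol m M ϱ, x ∈ M :=
  (withDensity_absolutelyContinuous _ _).ae_le (ae_restrict_mem hM)

theorem ContinuousOn.aestronglyMeasurable_volOn {F : Type*} [NormedAddCommGroup F]
    [SecondCountableTopology F] {f : EuclideanSpace ℝ (Fin d) → F}
    (hf : ContinuousOn f M) (hM : MeasurableSet M) : AEStronglyMeasurable f (volOn m M) :=
  hf.aestronglyMeasurable hM

theorem ContinuousOn.aestronglyMeasurable_weightedVol {F : Type*} [NormedAddCommGroup F]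
    [SecondCountableTopology F] {f : EuclideanSpace ℝ (Fin d) → F}
    (hf : ContinuousOn f M) (hM : MeasurableSet M) (ϱ : EuclideanSpace ℝ (Fin d) → ℝ) :
    AEStronglyMeasurable f (weightedVol m M ϱ) :=
  (hf.aestronglyMeasurable_volOn hM).mono_ac (withDensity_absolutelyContinuous _ _)

theorem integral_weightedVol (hM : MeasurableSet M) {ϱ : EuclideanSpace ℝ (Fin d) → ℝ}
    (hϱ : ContinuousOn ϱ M) (hϱ0 : ∀ x ∈ M, 0 ≤ ϱ x) (f : EuclideanSpace ℝ (Fin d) → ℝ) :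
    ∫ x, f x ∂weightedVol m M ϱ = ∫ x, ϱ x * f x ∂volOn m M := by
  rw [weightedVol, integral_withDensity_eq_integral_toReal_smul₀
    (hϱ.aestronglyMeasurable_volOn hM).aemeasurable.ennreal_ofReal (by simp)]
  refine integral_congr_ae ?_
  filter_upwards [ae_restrict_mem hM] with x hx
  rw [ENNReal.toReal_ofReal (hϱ0 x hx), smul_eq_mul]

theorem isProbabilityMeasure_weightedVol (hM : MeasurableSet M)
    {ϱ : EuclideanSpace ℝ (Fin d) → ℝ} (hϱ0 : ∀ x ∈ M, 0 ≤ ϱ x)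
    (h1 : ∫ x, ϱ x ∂volOn m M = 1) : IsProbabilityMeasure (weightedVol m M ϱ) := by
  refine ⟨?_⟩
  rw [weightedVol, withDensity_apply _ MeasurableSet.univ, Measure.restrict_univ,
    ← ofReal_integral_eq_lintegral_ofReal, h1, ENNReal.ofReal_one]
  · exact Integrable.of_integral_ne_zero (by rw [h1]; exact one_ne_zero)
  · filter_upwards [ae_restrict_mem hM] with x hx using hϱ0 x hx

/-- Weak gradients survive the passage to a weight which is dominated by the given one. -/
theorem HasWeakGradient.of_weightedVol_le {ϱ ϱ' : EuclideanSpace ℝ (Fin d) → ℝ} {c : ℝ≥0∞}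
    (hc : c ≠ ⊤) (hle : weightedVol m M ϱ' ≤ c • weightedVol m M ϱ)
    (hsub : M ∩ {x | 0 < ϱ' x} ⊆ M ∩ {x | 0 < ϱ x}) {u : EuclideanSpace ℝ (Fin d) → ℝ}
    {G : EuclideanSpace ℝ (Fin d) → EuclideanSpace ℝ (Fin d)} (h : HasWeakGradient m M ϱ u G) :
    HasWeakGradient m M ϱ' u G := by
  obtain ⟨φ, hφ, h1, h2⟩ := h.exists_approx
  have key : ∀ {F : Type} [NormedAddCommGroup F] {f : ℕ → EuclideanSpace ℝ (Fin d) → F},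
      Tendsto (fun n => eLpNorm (f n) 2 (weightedVol m M ϱ)) atTop (𝓝 0) →
      Tendsto (fun n => eLpNorm (f n) 2 (weightedVol m M ϱ')) atTop (𝓝 0) := by
    intro F _ f hf
    have h0 : Tendsto (fun n => c ^ (1 / (2 : ℝ≥0∞).toReal) * eLpNorm (f n) 2 (weightedVol m M ϱ))
        atTop (𝓝 0) := by
      have := ENNReal.Tendsto.const_mul (a := c ^ (1 / (2 : ℝ≥0∞).toReal)) hf
        (Or.inr (ENNReal.rpow_ne_top_of_nonneg (by simp) hc))
      simpa using this
    refine tendsto_of_tendsto_of_tendsto_of_le_of_le tendsto_const_nhds h0 (fun _ => zero_le)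
      fun n => ?_
    have := eLpNorm_le_of_measure_le_smul (p := 2) (f := f n) hle
    simpa using this
  exact ⟨h.memLp.of_measure_le_smul hc hle, h.memLp_gradient.of_measure_le_smul hc hle,
    φ, fun n => (hφ n).mono hsub, key h1, key h2⟩

theorem hasWeakGradient_of_contDiffOn {ϱ φ : EuclideanSpace ℝ (Fin d) → ℝ}
    (hφ : ContDiffOn ℝ 1 φ M) (h1 : MemLp φ 2 (weightedVol m M ϱ))
    (h2 : MemLp (gradOn M φ) 2 (weightedVol m M ϱ)) :
    HasWeakGradient m M ϱ φ (gradOn M φ) :=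
  ⟨h1, h2, fun _ => φ, fun _ => hφ.mono inter_subset_left, by simp, by simp⟩

theorem HasWeakGradient.sum_smul (hM : IsEmbeddedSubmanifold m M)
    {ϱ : EuclideanSpace ℝ (Fin d) → ℝ} (hϱ : ∀ x ∈ M, 0 < ϱ x) {ι : Type*} (T : Finset ι)
    {u : ι → EuclideanSpace ℝ (Fin d) → ℝ}
    {G : ι → EuclideanSpace ℝ (Fin d) → EuclideanSpace ℝ (Fin d)} (a : ι → ℝ)
    (h : ∀ i ∈ T, HasWeakGradient m M ϱ (u i) (G i)) :
    HasWeakGradient m M ϱ (fun x => ∑ i ∈ T, a i * u i x) (fun x => ∑ i ∈ T, a i • G i x) := by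
  have hpos : M ∩ {x | 0 < ϱ x} = M := inter_eq_left.2 fun x hx => hϱ x hx
  have hMm := hM.measurableSet
  have hex := fun (i : ι) (hi : i ∈ T) => (h i hi).exists_approx
  rw [hpos] at hex
  choose! φ hφ h1 h2 using hex
  have key : ∀ {F : Type} [NormedAddCommGroup F] [NormedSpace ℝ F]
      {f : ι → ℕ → EuclideanSpace ℝ (Fin d) → F},
      (∀ i ∈ T, ∀ n, AEStronglyMeasurable (f i n) (weightedVol m M ϱ)) →
      (∀ i ∈ T, Tendsto (fun n => eLpNorm (f i n) 2 (weightedVol m M ϱ)) atTop (𝓝 0)) →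
      Tendsto (fun n => eLpNorm (∑ i ∈ T, a i • f i n) 2 (weightedVol m M ϱ)) atTop (𝓝 0) := by
    intro F _ _ f hm hf
    have h0 : Tendsto (fun n => ∑ i ∈ T, ‖a i‖ₑ * eLpNorm (f i n) 2 (weightedVol m M ϱ))
        atTop (𝓝 0) := by
      have : (0 : ℝ≥0∞) = ∑ i ∈ T, ‖a i‖ₑ * 0 := by simp
      rw [this]
      exact tendsto_finsetSum _ fun i hi =>
        ENNReal.Tendsto.const_mul (hf i hi) (Or.inr enorm_ne_top)
    refine tendsto_of_tendsto_of_tendsto_of_le_of_le tendsto_const_nhds h0 (fun _ => zero_le)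
      fun n => ?_
    refine (eLpNorm_sum_le (fun i hi => (hm i hi n).const_smul (a i)) (by norm_num)).trans ?_
    exact Finset.sum_le_sum fun i _ => eLpNorm_const_smul_le
  refine ⟨?_, ?_, fun n x => ∑ i ∈ T, a i * φ i n x, fun n => ?_, ?_, ?_⟩
  · exact memLp_finsetSum T fun i hi => (h i hi).memLp.const_mul (a i)
  · exact memLp_finsetSum T fun i hi => (h i hi).memLp_gradient.const_smul (a i)
  · rw [hpos]
    exact ContDiffOn.sum fun i hi => contDiffOn_const.mul (hφ i hi n)
  · refine (key (f := fun i n x => φ i n x - u i x) (fun i hi n =>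
      ((hφ i hi n).continuousOn.aestronglyMeasurable_weightedVol hMm ϱ).sub
        (h i hi).memLp.1) h1).congr fun n => ?_
    congr 1
    ext x
    simp [Finset.sum_apply, mul_sub]
  · refine (key (f := fun i n x => gradOn M (φ i n) x - G i x) (fun i hi n =>
      ((hM.continuousOn_gradOn (hφ i hi n)).aestronglyMeasurable_weightedVol hMm ϱ).sub
        (h i hi).memLp_gradient.1) h2).congr fun n => ?_
    refine eLpNorm_congr_ae ?_
    filter_upwards [ae_mem_weightedVol hMm ϱ] with x hx
    rw [gradOn_sum_smul T a fun i hi => ((hφ i hi n).differentiableOn one_ne_zero) x hx]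
    simp [Finset.sum_apply, smul_sub]

end WeightedMeasure

section L2

variable {α F : Type*} [MeasurableSpace α] {μ : Measure α} [NormedAddCommGroup F]
  [InnerProductSpace ℝ F]

theorem MeasureTheory.MemLp.inner_toLp_toLp {f g : α → F} (hf : MemLp f 2 μ) (hg : MemLp g 2 μ) :
    inner ℝ (hf.toLp f) (hg.toLp g) = ∫ x, inner ℝ (f x) (g x) ∂μ := by
  rw [L2.inner_def]
  refine integral_congr_ae ?_
  filter_upwards [hf.coeFn_toLp, hg.coeFn_toLp] with x h1 h2
  rw [h1, h2]

theorem MeasureTheory.MemLp.norm_toLp_sq {f : α → F} (hf : MemLp f 2 μ) :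
    ‖hf.toLp f‖ ^ 2 = ∫ x, ‖f x‖ ^ 2 ∂μ := by
  rw [← real_inner_self_eq_norm_sq, hf.inner_toLp_toLp hf]
  simp_rw [real_inner_self_eq_norm_sq]

theorem MeasureTheory.MemLp.toLp_finset_sum_smul {ι : Type*} (T : Finset ι) {f : ι → α → F}
    (a : ι → ℝ) (hf : ∀ i, MemLp (f i) 2 μ) (h : MemLp (fun x => ∑ i ∈ T, a i • f i x) 2 μ) :
    h.toLp _ = ∑ i ∈ T, a i • (hf i).toLp (f i) := by
  classical
  induction T using Finset.induction_on with
  | empty =>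
    rw [Finset.sum_empty]
    exact (MemLp.toLp_congr h MemLp.zero (by simp; rfl)).trans (MemLp.toLp_zero _)
  | insert i T hi ih =>
    have h' : MemLp (fun x => ∑ i ∈ T, a i • f i x) 2 μ :=
      memLp_finsetSum T fun i _ => (hf i).const_smul (a i)
    rw [Finset.sum_insert hi, ← ih h', ← MemLp.toLp_const_smul, ← MemLp.toLp_add]
    refine MemLp.toLp_congr _ _ (ae_of_all _ fun x => ?_)
    simp [Finset.sum_insert hi]

end L2

/-! ### The spectrum and the Dirichlet form -/

section Spectrum

/-- Bessel's inequality for an orthogonal family `g` in which `‖g i‖² = lam i`. -/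
theorem sum_mul_sq_le_norm_sq_of_inner {H : Type*} [NormedAddCommGroup H] [InnerProductSpace ℝ H]
    {g : ℕ → H} {lam : ℕ → ℝ} (hg : ∀ i j, inner ℝ (g i) (g j) = if i = j then lam i else 0)
    {h : H} {c : ℕ → ℝ} (hc : ∀ i, inner ℝ (g i) h = lam i * c i) (T : Finset ℕ) :
    ∑ i ∈ T, lam i * c i ^ 2 ≤ ‖h‖ ^ 2 := by
  have h1 : inner ℝ (∑ i ∈ T, c i • g i) h = ∑ i ∈ T, lam i * c i ^ 2 := by
    rw [sum_inner]
    refine Finset.sum_congr rfl fun i _ => ?_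
    rw [inner_smul_left, hc, conj_trivial]; ring
  have h2 : ‖∑ i ∈ T, c i • g i‖ ^ 2 = ∑ i ∈ T, lam i * c i ^ 2 := by
    rw [← real_inner_self_eq_norm_sq, sum_inner]
    refine Finset.sum_congr rfl fun i hi => ?_
    rw [inner_sum]
    simp only [inner_smul_left, inner_smul_right, hg, conj_trivial]
    simp [hi]; ring
  have h3 := norm_sub_sq_real h (∑ i ∈ T, c i • g i)
  rw [real_inner_comm, h1, h2] at h3
  nlinarith [sq_nonneg ‖h - ∑ i ∈ T, c i • g i‖]

variable {d m N : ℕ} {M : Set (EuclideanSpace ℝ (Fin d))} {ϱ : EuclideanSpace ℝ (Fin d) → ℝ}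
  {e : HilbertBasis ℕ ℝ (WeightedL2 m M ϱ)} {lam : ℕ → ℝ}

/-- The weak gradients of the eigenfunctions represent the Dirichlet form. -/
theorem IsEigenbasis.exists_gradient (h : IsEigenbasis m M ϱ e lam) :
    ∃ G : ℕ → EuclideanSpace ℝ (Fin d) → EuclideanSpace ℝ (Fin d),
      (∀ i, HasWeakGradient m M ϱ (e i) (G i)) ∧
      ∀ i v H, ∀ hv : HasWeakGradient m M ϱ v H,
        ∫ x, inner ℝ (G i x) (H x) ∂weightedVol m M ϱ =
          lam i * inner ℝ (e i) (hv.memLp.toLp v) := by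
  choose _ G hG hGH using h.eigen
  refine ⟨G, hG, fun i v H hv => ?_⟩
  rw [hGH i v H hv, L2.inner_def, ← integral_const_mul]
  refine integral_congr_ae ?_
  filter_upwards [hv.memLp.coeFn_toLp] with x hx
  rw [hx]
  simp only [RCLike.inner_apply, conj_trivial]
  ring

/-- A function whose Dirichlet energy is `E` is within `√(E / lam n)` of the span of the first `n`
eigenfunctions. -/
theorem IsEigenbasis.mul_norm_sub_sum_sq_le (h : IsEigenbasis m M ϱ e lam) (n : ℕ)
    {v : EuclideanSpace ℝ (Fin d) → ℝ} {H : EuclideanSpace ℝ (Fin d) → EuclideanSpace ℝ (Fin d)}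
    (hv : HasWeakGradient m M ϱ v H) :
    lam n * ‖hv.memLp.toLp v - ∑ i : Fin n, inner ℝ (e i) (hv.memLp.toLp v) • e i‖ ^ 2 ≤
      ∫ x, ‖H x‖ ^ 2 ∂weightedVol m M ϱ := by
  obtain ⟨G, hG, hGH⟩ := h.exists_gradient
  set V := hv.memLp.toLp v with hV
  let g : ℕ → Lp (EuclideanSpace ℝ (Fin d)) 2 (weightedVol m M ϱ) :=
    fun i => (hG i).memLp_gradient.toLp (G i)
  have hg : ∀ i j, inner ℝ (g i) (g j) = if i = j then lam i else 0 := fun i j => by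
    rw [MemLp.inner_toLp_toLp, hGH i _ _ (hG j), Lp.toLp_coeFn,
      orthonormal_iff_ite.1 e.orthonormal i j]
    simp
  have hc : ∀ i, inner ℝ (g i) (hv.memLp_gradient.toLp H) = lam i * inner ℝ (e i) V := fun i => by
    rw [MemLp.inner_toLp_toLp, hGH i _ _ hv]
  rw [← hv.memLp_gradient.norm_toLp_sq]
  have hbes := sum_mul_sq_le_norm_sq_of_inner hg hc
  have horth : Orthonormal ℝ fun i : Fin n => e i := e.orthonormal.comp _ Fin.val_injective
  rw [← real_inner_self_eq_norm_sq, horth.inner_sub_sum_inner_smul, real_inner_self_eq_norm_sq]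
  have hsum := e.hasSum_inner_mul_inner V V
  rw [real_inner_self_eq_norm_sq] at hsum
  have hlim := ((hsum.tendsto_sum_nat).sub_const
    (∑ i : Fin n, inner ℝ (e i) V * inner ℝ (e i) V)).const_mul (lam n)
  refine le_of_tendsto hlim ?_
  filter_upwards [eventually_ge_atTop n] with k hk
  have hIco : ∑ i ∈ Finset.range k, inner ℝ V (e i) * inner ℝ (e i) V -
      ∑ i : Fin n, inner ℝ (e i) V * inner ℝ (e i) V =
        ∑ i ∈ Finset.Ico n k, inner ℝ (e i) V ^ 2 := by
    rw [Fin.sum_univ_eq_sum_range (fun i => inner ℝ (e i) V * inner ℝ (e i) V) n,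
      ← Finset.sum_range_add_sum_Ico _ hk]
    simp only [real_inner_comm, add_sub_cancel_left, sq]
  rw [hIco, Finset.mul_sum]
  refine le_trans (Finset.sum_le_sum fun i hi => ?_) (hbes (Finset.Ico n k))
  exact mul_le_mul_of_nonneg_right (h.mono (Finset.mem_Ico.1 hi).1) (sq_nonneg _)

/-- A variational lower bound for the eigenvalue `lam N`: it is enough to bound the Dirichlet form
from below on the common kernel of `N` linear functionals. -/
theorem IsEigenbasis.le_of_forall_le (hM : IsEmbeddedSubmanifold m M) (hϱ : ∀ x ∈ M, 0 < ϱ x)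
    (h : IsEigenbasis m M ϱ e lam) {Θ : ℝ} (ℓ : Fin N → WeightedL2 m M ϱ →ₗ[ℝ] ℝ)
    (hΘ : ∀ v H, ∀ hv : HasWeakGradient m M ϱ v H, (∀ k, ℓ k (hv.memLp.toLp v) = 0) →
      Θ * ∫ x, v x ^ 2 ∂weightedVol m M ϱ ≤ ∫ x, ‖H x‖ ^ 2 ∂weightedVol m M ϱ) :
    Θ ≤ lam N := by
  obtain ⟨G, hG, hGH⟩ := h.exists_gradient
  let L : (Fin (N + 1) → ℝ) →ₗ[ℝ] (Fin N → ℝ) :=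
    LinearMap.pi fun k => (ℓ k).comp (Fintype.linearCombination ℝ fun i : Fin (N + 1) => e i)
  -- `N` linear conditions on a combination of `N + 1` eigenfunctions have a nontrivial solution.
  obtain ⟨a, haL, ha0⟩ := (Submodule.ne_bot_iff _).1
    (LinearMap.ker_ne_bot_of_finrank_lt (f := L) (by simp))
  have haℓ : ∀ k, ℓ k (∑ i : Fin (N + 1), a i • e i) = 0 := fun k => by
    have := congrFun (LinearMap.mem_ker.1 haL) k
    simpa [L, Fintype.linearCombination_apply] using this
  have hv := HasWeakGradient.sum_smul hM hϱ Finset.univ a (fun (i : Fin (N + 1)) _ => hG i)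
  have hvL : hv.memLp.toLp _ = ∑ i : Fin (N + 1), a i • e i := by
    have := MemLp.toLp_finset_sum_smul Finset.univ a (fun i : Fin (N + 1) => (hG i).memLp) hv.memLp
    simpa using this
  have hgL := MemLp.toLp_finset_sum_smul Finset.univ a
    (fun i : Fin (N + 1) => (hG i).memLp_gradient) hv.memLp_gradient
  have h1 := hΘ _ _ hv (by rw [hvL]; exact haℓ)
  have horth : Orthonormal ℝ fun i : Fin (N + 1) => e i := e.orthonormal.comp _ Fin.val_injective
  have h2 : ∫ x, (∑ i : Fin (N + 1), a i * e i x) ^ 2 ∂weightedVol m M ϱ = ∑ i, a i ^ 2 := by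
    have := hv.memLp.norm_toLp_sq
    rw [hvL, ← real_inner_self_eq_norm_sq, horth.inner_sum] at this
    simp only [Real.norm_eq_abs, sq_abs] at this
    rw [← this]
    simp [sq]
  have h3 : ∫ x, ‖∑ i : Fin (N + 1), a i • G i x‖ ^ 2 ∂weightedVol m M ϱ =
      ∑ i : Fin (N + 1), lam i * a i ^ 2 := by
    rw [← hv.memLp_gradient.norm_toLp_sq, hgL, ← real_inner_self_eq_norm_sq, sum_inner]
    refine Finset.sum_congr rfl fun i _ => ?_
    rw [inner_sum]
    have : ∀ j : Fin (N + 1), inner ℝ ((hG i).memLp_gradient.toLp (G i))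
        ((hG j).memLp_gradient.toLp (G j)) = if i = j then lam i else 0 := fun j => by
      rw [MemLp.inner_toLp_toLp, hGH i _ _ (hG j), Lp.toLp_coeFn, orthonormal_iff_ite.1 horth i j]
      simp
    simp only [inner_smul_left, inner_smul_right, this, conj_trivial]
    simp; ring
  rw [h2, h3] at h1
  have hpos : 0 < ∑ i, a i ^ 2 := by
    obtain ⟨i, hi⟩ : ∃ i, a i ≠ 0 := by
      by_contra! hcon; exact ha0 (funext hcon)
    exact Finset.sum_pos' (fun _ _ => sq_nonneg _) ⟨i, Finset.mem_univ i, by positivity⟩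
  refine le_of_mul_le_mul_right (h1.trans ?_) hpos
  rw [Finset.mul_sum]
  refine Finset.sum_le_sum fun i _ => ?_
  exact mul_le_mul_of_nonneg_right (h.mono (by omega)) (sq_nonneg _)

end Spectrum

/-! ### Mixture models -/

section Mixture

variable {d m N : ℕ} {M : Set (EuclideanSpace ℝ (Fin d))} {w : Fin N → ℝ}
  {ρ : Fin N → EuclideanSpace ℝ (Fin d) → ℝ}

theorem spectralGap_mul_le {ϱ v : EuclideanSpace ℝ (Fin d) → ℝ}
    {G : EuclideanSpace ℝ (Fin d) → EuclideanSpace ℝ (Fin d)} (h : HasWeakGradient m M ϱ v G)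
    (h0 : ∫ x, v x ∂weightedVol m M ϱ = 0) :
    spectralGap m M ϱ * ∫ x, v x ^ 2 ∂weightedVol m M ϱ ≤ ∫ x, ‖G x‖ ^ 2 ∂weightedVol m M ϱ := by
  have hG : 0 ≤ ∫ x, ‖G x‖ ^ 2 ∂weightedVol m M ϱ := integral_nonneg fun _ => sq_nonneg _
  rcases (integral_nonneg fun x => sq_nonneg (v x) :
    0 ≤ ∫ x, v x ^ 2 ∂weightedVol m M ϱ).eq_or_lt with hv | hv
  · rwa [← hv, mul_zero]
  · rw [← le_div_iff₀ hv]
    refine csInf_le ⟨0, ?_⟩ ⟨v, G, h, h0, hv, rfl⟩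
    rintro _ ⟨v, G, -, -, -, rfl⟩
    exact div_nonneg (integral_nonneg fun _ => sq_nonneg _) (integral_nonneg fun _ => sq_nonneg _)

namespace IsMixtureModel

theorem contDiffOn_mixtureDensity (h : IsMixtureModel m M w ρ) :
    ContDiffOn ℝ 1 (mixtureDensity w ρ) M := by
  have : mixtureDensity w ρ = fun x => ∑ k, w k * ρ k x := rfl
  rw [this]
  exact ContDiffOn.sum fun k _ => contDiffOn_const.mul (h.contDiffOn k)

theorem weightedVol_mixtureDensity (h : IsMixtureModel m M w ρ) (hM : MeasurableSet M) :
    weightedVol m M (mixtureDensity w ρ) = ∑ k, ENNReal.ofReal (w k) • weightedVol m M (ρ k) := by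
  have hmeas : ∀ k, AEMeasurable (fun x => ENNReal.ofReal (ρ k x)) (volOn m M) := fun k =>
    ((h.contDiffOn k).continuousOn.aestronglyMeasurable_volOn hM).aemeasurable.ennreal_ofReal
  ext s hs
  simp only [weightedVol, Measure.coe_finsetSum, Finset.sum_apply, Measure.smul_apply,
    withDensity_apply _ hs, smul_eq_mul]
  rw [← Finset.sum_congr rfl fun k _ => lintegral_const_mul'' (ENNReal.ofReal (w k))
    (hmeas k).restrict, ← lintegral_finsetSum' _ fun k _ => (hmeas k).restrict.const_mul _]
  refine lintegral_congr_ae (ae_restrict_of_ae ?_)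
  filter_upwards [ae_restrict_mem hM] with x hx
  rw [mixtureDensity, ENNReal.ofReal_sum_of_nonneg
    fun k _ => mul_nonneg (h.weight_pos k).le (h.nonneg k x hx)]
  exact Finset.sum_congr rfl fun k _ => ENNReal.ofReal_mul (h.weight_pos k).le

theorem integrable (h : IsMixtureModel m M w ρ) (k : Fin N) : Integrable (ρ k) (volOn m M) :=
  Integrable.of_integral_ne_zero (by rw [h.integral_eq_one]; exact one_ne_zero)

theorem isProbabilityMeasure_mixture (h : IsMixtureModel m M w ρ) (hM : MeasurableSet M) :
    IsProbabilityMeasure (weightedVol m M (mixtureDensity w ρ)) := by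
  refine isProbabilityMeasure_weightedVol hM (fun x hx => (h.mixture_pos x hx).le) ?_
  simp only [mixtureDensity]
  rw [integral_finsetSum _ fun k _ => (h.integrable k).const_mul (w k)]
  simp_rw [integral_const_mul, h.integral_eq_one, mul_one, h.weight_sum]

theorem weightedVol_le (h : IsMixtureModel m M w ρ) (hM : MeasurableSet M) (k : Fin N) :
    weightedVol m M (ρ k) ≤
      (ENNReal.ofReal (w k))⁻¹ • weightedVol m M (mixtureDensity w ρ) := by
  have hw0 : ENNReal.ofReal (w k) ≠ 0 := (ENNReal.ofReal_pos.2 (h.weight_pos k)).ne'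
  have h1 : ENNReal.ofReal (w k) • weightedVol m M (ρ k) ≤
      weightedVol m M (mixtureDensity w ρ) := by
    rw [h.weightedVol_mixtureDensity hM]
    exact Finset.single_le_sum (f := fun k => ENNReal.ofReal (w k) • weightedVol m M (ρ k))
      (fun _ _ => Measure.zero_le _) (Finset.mem_univ k)
  refine Measure.le_iff.2 fun s hs => ?_
  have h2 := Measure.le_iff.1 h1 s hs
  simp only [Measure.smul_apply, smul_eq_mul] at h2 ⊢
  rwa [← ENNReal.mul_le_iff_le_inv hw0 ENNReal.ofReal_ne_top]

theorem integral_mixture (h : IsMixtureModel m M w ρ) (hM : MeasurableSet M)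
    {f : EuclideanSpace ℝ (Fin d) → ℝ}
    (hf : Integrable f (weightedVol m M (mixtureDensity w ρ))) :
    ∫ x, f x ∂weightedVol m M (mixtureDensity w ρ) =
      ∑ k, w k * ∫ x, f x ∂weightedVol m M (ρ k) := by
  have hk : ∀ k, Integrable f (weightedVol m M (ρ k)) := fun k =>
    hf.of_measure_le_smul (ENNReal.inv_ne_top.2 (ENNReal.ofReal_pos.2 (h.weight_pos k)).ne')
      (h.weightedVol_le hM k)
  rw [h.weightedVol_mixtureDensity hM, integral_finsetSum_measure
    fun k _ => (hk k).smul_measure ENNReal.ofReal_ne_top]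
  refine Finset.sum_congr rfl fun k _ => ?_
  rw [integral_smul_measure, ENNReal.toReal_ofReal (h.weight_pos k).le, smul_eq_mul]

theorem hasWeakGradient_component (h : IsMixtureModel m M w ρ) (hM : MeasurableSet M)
    {v : EuclideanSpace ℝ (Fin d) → ℝ} {G : EuclideanSpace ℝ (Fin d) → EuclideanSpace ℝ (Fin d)}
    (hv : HasWeakGradient m M (mixtureDensity w ρ) v G) (k : Fin N) :
    HasWeakGradient m M (ρ k) v G :=
  hv.of_weightedVol_le (ENNReal.inv_ne_top.2 (ENNReal.ofReal_pos.2 (h.weight_pos k)).ne')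
    (h.weightedVol_le hM k) fun x hx => ⟨hx.1, h.mixture_pos x hx.1⟩

end IsMixtureModel

theorem integral_div_le_overlap (w : Fin N → ℝ) (ρ : Fin N → EuclideanSpace ℝ (Fin d) → ℝ)
    {i j : Fin N} (hij : i ≠ j) :
    ∫ x, ρ i x * ρ j x / mixtureDensity w ρ x ∂volOn m M ≤ overlap m M w ρ :=
  le_ciSup (f := fun p : {p : Fin N × Fin N // p.1 ≠ p.2} =>
    ∫ x, ρ p.1.1 x * ρ p.1.2 x / mixtureDensity w ρ x ∂(volOn m M))
    (Set.finite_range _).bddAbove ⟨(i, j), hij⟩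

theorem IsMixtureModel.overlap_nonneg (h : IsMixtureModel m M w ρ) (hM : MeasurableSet M) :
    0 ≤ overlap m M w ρ := by
  refine Real.iSup_nonneg fun p => integral_nonneg_of_ae ?_
  filter_upwards [ae_restrict_mem hM] with x hx
  exact div_nonneg (mul_nonneg (h.nonneg _ x hx) (h.nonneg _ x hx)) (h.mixture_pos x hx).le

theorem wMin_le (w : Fin N → ℝ) (k : Fin N) : wMin w ≤ w k :=
  ciInf_le (Set.finite_range _).bddBelow k

theorem le_wMax (w : Fin N → ℝ) (k : Fin N) : w k ≤ wMax w :=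
  le_ciSup (Set.finite_range _).bddAbove k

theorem IsMixtureModel.wMin_pos (h : IsMixtureModel m M w ρ) [Nonempty (Fin N)] :
    0 < wMin w := by
  obtain ⟨k, hk⟩ := exists_eq_ciInf_of_finite (f := w)
  rw [wMin, ← hk]
  exact h.weight_pos k

theorem indivisibility_le (m : ℕ) (M : Set (EuclideanSpace ℝ (Fin d)))
    (ρ : Fin N → EuclideanSpace ℝ (Fin d) → ℝ) (k : Fin N) :
    indivisibility m M ρ ≤ spectralGap m M (ρ k) :=
  ciInf_le (Set.finite_range _).bddBelow k

/-! ### The square roots of the relative component densities -/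

/-- The function `q_k = √(ρ_k / ρ)`. These functions are almost orthonormal in `L²(ρ)`, and their
Dirichlet energies are the numbers `𝒞_k`. -/
noncomputable def componentRoot (w : Fin N → ℝ) (ρ : Fin N → EuclideanSpace ℝ (Fin d) → ℝ)
    (k : Fin N) (x : EuclideanSpace ℝ (Fin d)) : ℝ :=
  √(ρ k x / mixtureDensity w ρ x)

theorem componentRoot_nonneg (w : Fin N → ℝ) (ρ : Fin N → EuclideanSpace ℝ (Fin d) → ℝ)
    (k : Fin N) (x : EuclideanSpace ℝ (Fin d)) : 0 ≤ componentRoot w ρ k x :=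
  Real.sqrt_nonneg _

namespace IsMixtureModel

theorem componentRoot_sq (h : IsMixtureModel m M w ρ) (k : Fin N) {x : EuclideanSpace ℝ (Fin d)}
    (hx : x ∈ M) : componentRoot w ρ k x ^ 2 = ρ k x / mixtureDensity w ρ x :=
  Real.sq_sqrt (div_nonneg (h.nonneg k x hx) (h.mixture_pos x hx).le)

theorem sum_mul_componentRoot_sq (h : IsMixtureModel m M w ρ) {x : EuclideanSpace ℝ (Fin d)}
    (hx : x ∈ M) : ∑ k, w k * componentRoot w ρ k x ^ 2 = 1 := by
  simp_rw [h.componentRoot_sq _ hx, ← mul_div_assoc]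
  rw [← Finset.sum_div]
  exact div_self (h.mixture_pos x hx).ne'

theorem componentRoot_sq_le (h : IsMixtureModel m M w ρ) (k : Fin N)
    {x : EuclideanSpace ℝ (Fin d)} (hx : x ∈ M) : componentRoot w ρ k x ^ 2 ≤ (w k)⁻¹ := by
  rw [← one_div, le_div_iff₀' (h.weight_pos k), ← h.sum_mul_componentRoot_sq hx]
  exact Finset.single_le_sum (f := fun k => w k * componentRoot w ρ k x ^ 2)
    (fun j _ => mul_nonneg (h.weight_pos j).le (sq_nonneg _)) (Finset.mem_univ k)

theorem componentRoot_le (h : IsMixtureModel m M w ρ) (k : Fin N)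
    {x : EuclideanSpace ℝ (Fin d)} (hx : x ∈ M) : componentRoot w ρ k x ≤ √(w k)⁻¹ :=
  Real.le_sqrt_of_sq_le (h.componentRoot_sq_le k hx)

theorem continuousOn_componentRoot (h : IsMixtureModel m M w ρ) (k : Fin N) :
    ContinuousOn (componentRoot w ρ k) M :=
  ((h.contDiffOn k).continuousOn.div h.contDiffOn_mixtureDensity.continuousOn
    fun x hx => (h.mixture_pos x hx).ne').sqrt

/-- Continuous functions which are bounded on `M` belong to `Lᵖ(ρ)`. -/
theorem memLp_of_continuousOn (h : IsMixtureModel m M w ρ) (hM : MeasurableSet M)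
    {f : EuclideanSpace ℝ (Fin d) → ℝ} (hf : ContinuousOn f M) (C : ℝ)
    (hC : ∀ x ∈ M, |f x| ≤ C) (p : ℝ≥0∞) :
    MemLp f p (weightedVol m M (mixtureDensity w ρ)) := by
  have := h.isProbabilityMeasure_mixture hM
  refine MemLp.of_bound (hf.aestronglyMeasurable_weightedVol hM _) C ?_
  filter_upwards [ae_mem_weightedVol hM _] with x hx using hC x hx

theorem memLp_componentRoot (h : IsMixtureModel m M w ρ) (hM : MeasurableSet M) (k : Fin N) :
    MemLp (componentRoot w ρ k) 2 (weightedVol m M (mixtureDensity w ρ)) :=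
  h.memLp_of_continuousOn hM (h.continuousOn_componentRoot k) (√(w k)⁻¹) (fun x hx => by
    rw [abs_of_nonneg (componentRoot_nonneg w ρ k x)]; exact h.componentRoot_le k hx) 2

theorem memLp_componentRoot_sq (h : IsMixtureModel m M w ρ) (hM : MeasurableSet M) (k : Fin N) :
    MemLp (fun x => componentRoot w ρ k x ^ 2) 2 (weightedVol m M (mixtureDensity w ρ)) :=
  h.memLp_of_continuousOn hM ((h.continuousOn_componentRoot k).pow 2) (w k)⁻¹ (fun x hx => by
    rw [abs_of_nonneg (sq_nonneg _)]; exact h.componentRoot_sq_le k hx) 2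

theorem integral_componentRoot_sq_mul (h : IsMixtureModel m M w ρ) (hM : MeasurableSet M)
    (k : Fin N) (f : EuclideanSpace ℝ (Fin d) → ℝ) :
    ∫ x, componentRoot w ρ k x ^ 2 * f x ∂weightedVol m M (mixtureDensity w ρ) =
      ∫ x, f x ∂weightedVol m M (ρ k) := by
  rw [integral_weightedVol hM h.contDiffOn_mixtureDensity.continuousOn
    (fun x hx => (h.mixture_pos x hx).le), integral_weightedVol hM (h.contDiffOn k).continuousOn
    (h.nonneg k)]
  refine integral_congr_ae ?_
  filter_upwards [ae_restrict_mem hM] with x hx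
  have := (h.mixture_pos x hx).ne'
  rw [h.componentRoot_sq k hx]
  field_simp

theorem norm_toLp_componentRoot (h : IsMixtureModel m M w ρ) (hM : MeasurableSet M) (k : Fin N) :
    ‖(h.memLp_componentRoot hM k).toLp _‖ = 1 := by
  have := isProbabilityMeasure_weightedVol hM (h.nonneg k) (h.integral_eq_one k)
  have h1 := (h.memLp_componentRoot hM k).norm_toLp_sq
  have h2 := h.integral_componentRoot_sq_mul hM k fun _ => 1
  simp only [Real.norm_eq_abs, sq_abs, mul_one] at h1 h2
  rw [h2, integral_const, probReal_univ, one_smul] at h1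
  exact (pow_eq_one_iff_of_nonneg (norm_nonneg _) two_ne_zero).1 h1

theorem integral_componentRoot_sq_mul_sq_le (h : IsMixtureModel m M w ρ) (hM : MeasurableSet M)
    {k l : Fin N} (hkl : k ≠ l) :
    ∫ x, componentRoot w ρ k x ^ 2 * componentRoot w ρ l x ^ 2
      ∂weightedVol m M (mixtureDensity w ρ) ≤ overlap m M w ρ := by
  rw [h.integral_componentRoot_sq_mul hM, integral_weightedVol hM (h.contDiffOn k).continuousOn
    (h.nonneg k)]
  refine le_trans (le_of_eq (integral_congr_ae ?_)) (integral_div_le_overlap w ρ hkl)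
  filter_upwards [ae_restrict_mem hM] with x hx
  rw [h.componentRoot_sq l hx, mul_div_assoc]

/-- By the Cauchy–Schwarz inequality, `∫ q_k q_l dν ≤ (∫ q_k² q_l² dν)^(1/2)`. -/
theorem abs_inner_componentRoot_le (h : IsMixtureModel m M w ρ) (hM : MeasurableSet M)
    {k l : Fin N} (hkl : k ≠ l) :
    |inner ℝ ((h.memLp_componentRoot hM k).toLp _) ((h.memLp_componentRoot hM l).toLp _)| ≤
      √(overlap m M w ρ) := by
  have := h.isProbabilityMeasure_mixture hM
  have hp : MemLp (fun x => componentRoot w ρ k x * componentRoot w ρ l x) 2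
      (weightedVol m M (mixtureDensity w ρ)) := by
    refine h.memLp_of_continuousOn hM ((h.continuousOn_componentRoot k).mul
      (h.continuousOn_componentRoot l)) (√(w k)⁻¹ * √(w l)⁻¹) (fun x hx => ?_) 2
    have hk := componentRoot_nonneg w ρ k x
    have hl := componentRoot_nonneg w ρ l x
    rw [Pi.mul_apply, abs_of_nonneg (mul_nonneg hk hl)]
    exact mul_le_mul (h.componentRoot_le k hx) (h.componentRoot_le l hx) hl (Real.sqrt_nonneg _)
  have h1 : MemLp (fun _ : EuclideanSpace ℝ (Fin d) => (1 : ℝ)) 2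
      (weightedVol m M (mixtureDensity w ρ)) := memLp_const 1
  have h2 := abs_real_inner_le_norm (h1.toLp _) (hp.toLp _)
  have h3 : ‖h1.toLp _‖ ^ 2 = 1 := by rw [h1.norm_toLp_sq]; simp
  have h4 : ‖h1.toLp _‖ = 1 := (pow_eq_one_iff_of_nonneg (norm_nonneg _) two_ne_zero).1 h3
  rw [h1.inner_toLp_toLp hp, h4, one_mul] at h2
  rw [MemLp.inner_toLp_toLp]
  have h5 : ‖hp.toLp _‖ ≤ √(overlap m M w ρ) := by
    refine Real.le_sqrt_of_sq_le ?_
    rw [hp.norm_toLp_sq]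
    refine le_trans (le_of_eq ?_) (h.integral_componentRoot_sq_mul_sq_le hM hkl)
    simp only [Real.norm_eq_abs, sq_abs, mul_pow]
  refine le_trans (le_of_eq ?_) (h2.trans h5)
  congr 1
  refine integral_congr_ae (ae_of_all _ fun x => ?_)
  simp [mul_comm]

/-- The smoothed root `smoothSqrt ε (ρ_k / ρ)` belongs to `H¹(ρ)`, and its Dirichlet energy is at
most `𝒞_k`. The derivative of `smoothSqrt ε` vanishes at `0`, so the zero set of `ρ_k` contributes
nothing. -/
theorem smoothSqrt_hasWeakGradient (h : IsMixtureModel m M w ρ) (hM : IsEmbeddedSubmanifold m M)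
    (k : Fin N) (hC : couplingAt m M w ρ k ≠ ⊤) {ε : ℝ} (hε : 0 < ε) :
    ∃ H, HasWeakGradient m M (mixtureDensity w ρ)
        (fun x => smoothSqrt ε (ρ k x / mixtureDensity w ρ x)) H ∧
      ∫ x, ‖H x‖ ^ 2 ∂weightedVol m M (mixtureDensity w ρ) ≤ (couplingAt m M w ρ k).toReal := by
  have hMm := hM.measurableSet
  set φ := fun x => smoothSqrt ε (ρ k x / mixtureDensity w ρ x) with hφdef
  have hφ : ContDiffOn ℝ 1 φ M :=
    (contDiff_smoothSqrt hε).comp_contDiffOn ((h.contDiffOn k).div h.contDiffOn_mixtureDensity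
      fun x hx => (h.mixture_pos x hx).ne')
  have hgc := hM.continuousOn_gradOn hφ
  have hgm := hgc.aestronglyMeasurable_weightedVol (m := m) hMm (mixtureDensity w ρ)
  have hen : ∫⁻ x, ENNReal.ofReal (‖gradOn M φ x‖ ^ 2) ∂weightedVol m M (mixtureDensity w ρ) ≤
      couplingAt m M w ρ k := by
    rw [weightedVol, lintegral_withDensity_eq_lintegral_mul₀
      (h.contDiffOn_mixtureDensity.continuousOn.aestronglyMeasurable_volOn
        hMm).aemeasurable.ennreal_ofReal
      (g := fun x => ENNReal.ofReal (‖gradOn M φ x‖ ^ 2))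
      ((hgc.aestronglyMeasurable_volOn hMm).norm.pow 2).aemeasurable.ennreal_ofReal]
    -- `ρ k` is only known on `M`, so its positivity set is measurable only up to a null set.
    have hnull : NullMeasurableSet {x | 0 < ρ k x} (volOn m M) :=
      nullMeasurableSet_lt aemeasurable_const
        ((h.contDiffOn k).continuousOn.aestronglyMeasurable_volOn hMm).aemeasurable
    rw [couplingAt, ← lintegral_const_mul' _ _ (by simp), ← lintegral_indicator₀ hnull]
    refine lintegral_mono_ae ?_
    filter_upwards [ae_restrict_mem hMm] with x hx
    have hρ := h.mixture_pos x hx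
    have hgrad : gradOn M φ x = _ := gradOn_comp_div
      ((h.contDiffOn k).differentiableOn one_ne_zero x hx)
      (h.contDiffOn_mixtureDensity.differentiableOn one_ne_zero x hx) hρ.ne'
      (hasDerivAt_smoothSqrt hε (ρ k x / mixtureDensity w ρ x))
    rw [Pi.mul_apply, hgrad]
    rcases (h.nonneg k x hx).eq_or_lt with h0 | h0
    · rw [← h0, zero_div, smoothSqrtDeriv_zero, zero_smul]
      simp
    · rw [indicator_of_mem (by exact h0), ← ENNReal.ofReal_mul hρ.le,
        show (1 / 4 : ℝ≥0∞) = ENNReal.ofReal (1 / 4) by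
          rw [ENNReal.ofReal_div_of_pos (by norm_num)]; simp,
        ← ENNReal.ofReal_mul (by norm_num)]
      refine ENNReal.ofReal_le_ofReal ?_
      set r := ρ k x / mixtureDensity w ρ x with hr
      have hr0 : 0 < r := div_pos h0 hρ
      -- `∇(ρ_k / ρ) = r (∇ρ_k / ρ_k - ∇ρ / ρ)` with `r = ρ_k / ρ`.
      have hfac : (mixtureDensity w ρ x)⁻¹ • gradOn M (ρ k) x -
          (r * (mixtureDensity w ρ x)⁻¹) • gradOn M (mixtureDensity w ρ) x =
          r • ((ρ k x)⁻¹ • gradOn M (ρ k) x -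
            (mixtureDensity w ρ x)⁻¹ • gradOn M (mixtureDensity w ρ) x) := by
        rw [smul_sub, smul_smul, smul_smul]
        congr 2
        rw [hr]; field_simp
      rw [hfac, norm_smul, norm_smul]
      set Z := ‖(ρ k x)⁻¹ • gradOn M (ρ k) x -
            (mixtureDensity w ρ x)⁻¹ • gradOn M (mixtureDensity w ρ) x‖
      have hb := smoothSqrtDeriv_sq_mul_le hε hr0.le
      have hrk : ρ k x = r * mixtureDensity w ρ x := by rw [hr]; field_simp
      rw [mul_pow, mul_pow, Real.norm_eq_abs, Real.norm_eq_abs, sq_abs, sq_abs, hrk]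
      calc mixtureDensity w ρ x * (smoothSqrtDeriv ε r ^ 2 * (r ^ 2 * Z ^ 2))
          = (smoothSqrtDeriv ε r ^ 2 * r) * (r * mixtureDensity w ρ x * Z ^ 2) := by ring
        _ ≤ 1 / 4 * (r * mixtureDensity w ρ x * Z ^ 2) := by gcongr
        _ = _ := by ring
  have hint : Integrable (fun x => ‖gradOn M φ x‖ ^ 2)
      (weightedVol m M (mixtureDensity w ρ)) := by
    refine ⟨hgm.norm.pow 2, ?_⟩
    rw [hasFiniteIntegral_iff_ofReal (ae_of_all _ fun _ => sq_nonneg _)]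
    exact hen.trans_lt hC.lt_top
  refine ⟨gradOn M φ, hasWeakGradient_of_contDiffOn hφ ?_
    ((memLp_two_iff_integrable_sq_norm hgm).2 hint), ?_⟩
  · refine h.memLp_of_continuousOn hMm hφ.continuousOn (√(w k)⁻¹ + ε * (Real.pi / 2))
      (fun x hx => ?_) 2
    have h1 := abs_smoothSqrt_sub_sqrt_le hε (ρ k x / mixtureDensity w ρ x)
    have h2 := h.componentRoot_le k hx
    have h3 := componentRoot_nonneg w ρ k x
    rw [componentRoot] at h2 h3
    rw [hφdef]
    have h4 := abs_le.1 h1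
    exact abs_le.2 ⟨by linarith [Real.sqrt_nonneg (w k)⁻¹, h4.1], by linarith [h4.2]⟩
  · rw [integral_eq_lintegral_of_nonneg_ae (ae_of_all _ fun _ => sq_nonneg _) hint.1]
    exact ENNReal.toReal_mono hC hen

/-- Orthogonality of a function to all the `q_k²` says that its mean for each component density
vanishes. Adding up the Poincaré inequalities of the components shows that the eigenvalue of index
`N` is at least `Θ`. -/
theorem indivisibility_le_eigenvalue (h : IsMixtureModel m M w ρ) (hM : IsEmbeddedSubmanifold m M)
    {e : HilbertBasis ℕ ℝ (WeightedL2 m M (mixtureDensity w ρ))} {lam : ℕ → ℝ}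
    (he : IsEigenbasis m M (mixtureDensity w ρ) e lam) :
    indivisibility m M ρ ≤ lam N := by
  have hMm := hM.measurableSet
  refine he.le_of_forall_le hM h.mixture_pos
    (fun k => innerₛₗ ℝ ((h.memLp_componentRoot_sq hMm k).toLp _)) fun v H hv hℓ => ?_
  have hmean : ∀ k, ∫ x, v x ∂weightedVol m M (ρ k) = 0 := fun k => by
    have h1 := hℓ k
    rw [innerₛₗ_apply_apply, MemLp.inner_toLp_toLp] at h1
    rw [← h.integral_componentRoot_sq_mul hMm, ← h1]
    refine integral_congr_ae (ae_of_all _ fun x => ?_)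
    simp [mul_comm]
  rw [h.integral_mixture hMm hv.memLp.integrable_sq,
    h.integral_mixture hMm ((memLp_two_iff_integrable_sq_norm hv.memLp_gradient.1).1
      hv.memLp_gradient), Finset.mul_sum]
  refine Finset.sum_le_sum fun k _ => ?_
  have h1 := spectralGap_mul_le (h.hasWeakGradient_component hMm hv k) (hmean k)
  have h2 : 0 ≤ ∫ x, v x ^ 2 ∂weightedVol m M (ρ k) := integral_nonneg fun _ => sq_nonneg _
  calc indivisibility m M ρ * (w k * ∫ x, v x ^ 2 ∂weightedVol m M (ρ k))
      = w k * (indivisibility m M ρ * ∫ x, v x ^ 2 ∂weightedVol m M (ρ k)) := by ring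
    _ ≤ _ := mul_le_mul_of_nonneg_left
      ((mul_le_mul_of_nonneg_right (indivisibility_le m M ρ k) h2).trans h1) (h.weight_pos k).le

/-- The functions `q_k` are close to the span of the first `N` eigenfunctions, since their Dirichlet
energy is small compared to the next eigenvalue. -/
theorem norm_componentRoot_sub_le (h : IsMixtureModel m M w ρ) (hM : IsEmbeddedSubmanifold m M)
    {e : HilbertBasis ℕ ℝ (WeightedL2 m M (mixtureDensity w ρ))} {lam : ℕ → ℝ}
    (he : IsEigenbasis m M (mixtureDensity w ρ) e lam) (hΘ : 0 < indivisibility m M ρ)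
    (hC : coupling m M w ρ ≠ ⊤) (k : Fin N) :
    ‖(h.memLp_componentRoot hM.measurableSet k).toLp _ - ∑ i : Fin N,
      inner ℝ (e i) ((h.memLp_componentRoot hM.measurableSet k).toLp _) • e i‖ ≤
      √((coupling m M w ρ).toReal / indivisibility m M ρ) := by
  have hMm := hM.measurableSet
  have := h.isProbabilityMeasure_mixture hMm
  have hCk : couplingAt m M w ρ k ≤ coupling m M w ρ := le_iSup (couplingAt m M w ρ) k
  have hCk' := (hCk.trans_lt hC.lt_top).ne
  have horth : Orthonormal ℝ fun i : Fin N => e i := e.orthonormal.comp _ Fin.val_injective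
  set Q := (h.memLp_componentRoot hMm k).toLp _
  refine le_of_forall_pos_le_add fun δ hδ => ?_
  set ε := δ / (Real.pi / 2) with hεdef
  have hε : 0 < ε := by positivity
  obtain ⟨H, hH, hen⟩ := h.smoothSqrt_hasWeakGradient hM k hCk' hε
  set V := hH.memLp.toLp _
  have h1 := (he.mul_norm_sub_sum_sq_le N hH).trans
    (hen.trans (ENNReal.toReal_mono hC hCk))
  have h2 : ‖V - ∑ i : Fin N, inner ℝ (e i) V • e i‖ ≤
      √((coupling m M w ρ).toReal / indivisibility m M ρ) := by
    refine Real.le_sqrt_of_sq_le ?_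
    rw [le_div_iff₀' hΘ]
    exact (mul_le_mul_of_nonneg_right (h.indivisibility_le_eigenvalue hM he)
      (sq_nonneg _)).trans h1
  have h3 : ‖Q - V‖ ≤ δ := by
    have h4 : ∀ᵐ x ∂weightedVol m M (mixtureDensity w ρ), ‖(Q - V) x‖ ≤ δ := by
      filter_upwards [(h.memLp_componentRoot hMm k).coeFn_toLp, hH.memLp.coeFn_toLp,
        Lp.coeFn_sub Q V] with x hx1 hx2 hx3
      rw [hx3, Pi.sub_apply, hx1, hx2, norm_sub_rev]
      have := abs_smoothSqrt_sub_sqrt_le hε (ρ k x / mixtureDensity w ρ x)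
      rw [hεdef, div_mul_cancel₀ _ (by positivity), ← hεdef] at this
      exact this
    have := Lp.norm_le_of_ae_bound hδ.le h4
    simpa [measureUnivNNReal] using this
  -- The orthogonal projection of `Q` is at least as close to `Q` as that of the smoothed root `V`.
  have h5 : ‖Q - ∑ i : Fin N, inner ℝ (e i) Q • e i‖ ≤
      ‖Q - ∑ i : Fin N, inner ℝ (e i) V • e i‖ := by
    refine le_of_sq_le_sq ?_ (norm_nonneg _)
    rw [horth.norm_sub_sum_smul_sq Q fun i => inner ℝ (e i) V]
    exact le_add_of_nonneg_right (Finset.sum_nonneg fun _ _ => sq_nonneg _)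
  refine h5.trans ?_
  rw [← sub_add_sub_cancel Q V]
  exact (norm_add_le _ _).trans (by linarith)

end IsMixtureModel

end Mixture

/-! ### Exceptional sets and cones -/

section Cones

variable {d m N : ℕ} {M : Set (EuclideanSpace ℝ (Fin d))} {w : Fin N → ℝ}
  {ρ : Fin N → EuclideanSpace ℝ (Fin d) → ℝ}

/-- The pointwise overlap `∑_j w_j q_j² ∑_{k ≠ j} q_k²` of the components. Where it is small, the
vector `(q_1, …, q_N)` is close to one of the coordinate axes. -/
noncomputable def pointOverlap (w : Fin N → ℝ) (ρ : Fin N → EuclideanSpace ℝ (Fin d) → ℝ)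
    (x : EuclideanSpace ℝ (Fin d)) : ℝ :=
  ∑ j, w j * ∑ k ∈ Finset.univ.erase j, componentRoot w ρ j x ^ 2 * componentRoot w ρ k x ^ 2

namespace IsMixtureModel

theorem pointOverlap_nonneg (h : IsMixtureModel m M w ρ) (x : EuclideanSpace ℝ (Fin d)) :
    0 ≤ pointOverlap w ρ x :=
  Finset.sum_nonneg fun j _ => mul_nonneg (h.weight_pos j).le (Finset.sum_nonneg fun _ _ =>
    mul_nonneg (sq_nonneg _) (sq_nonneg _))

/-- Since `∑ w_j q_j² = 1`, also `∑ w_j q_j⁴ ≥ 1`. If every `q_j²` were at most `c ∑ q_k²`, this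
would force the pointwise overlap to be at least `(1 - c) / c`. -/
theorem exists_mul_sum_lt_componentRoot_sq (h : IsMixtureModel m M w ρ)
    {x : EuclideanSpace ℝ (Fin d)} (hx : x ∈ M) {c : ℝ} (hc : 0 < c)
    (hlt : pointOverlap w ρ x < (1 - c) / c) :
    ∃ j, c * ∑ k, componentRoot w ρ k x ^ 2 < componentRoot w ρ j x ^ 2 := by
  by_contra! hcon
  rw [lt_div_iff₀ hc] at hlt
  set q := fun k => componentRoot w ρ k x ^ 2
  have hsum : ∑ k, w k * q k = 1 := h.sum_mul_componentRoot_sq hx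
  have h1 : 1 ≤ ∑ j, w j * q j ^ 2 := by
    have : 0 ≤ ∑ j, w j * (q j - 1) ^ 2 :=
      Finset.sum_nonneg fun j _ => mul_nonneg (h.weight_pos j).le (sq_nonneg _)
    have h2 : ∑ j, w j * (q j - 1) ^ 2 =
        ∑ j, w j * q j ^ 2 - 2 * ∑ j, w j * q j + ∑ j, w j := by
      rw [Finset.mul_sum, ← Finset.sum_sub_distrib, ← Finset.sum_add_distrib]
      exact Finset.sum_congr rfl fun j _ => by ring
    rw [h2, hsum, h.weight_sum] at this
    linarith
  have h3 : (1 - c) * ∑ j, w j * q j ^ 2 ≤ pointOverlap w ρ x * c := by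
    rw [pointOverlap, Finset.mul_sum, Finset.sum_mul]
    refine Finset.sum_le_sum fun j _ => ?_
    rw [← Finset.mul_sum]
    have h4 := hcon j
    rw [← Finset.add_sum_erase _ _ (Finset.mem_univ j)] at h4
    have h5 : 0 ≤ w j * q j := mul_nonneg (h.weight_pos j).le (sq_nonneg _)
    have h6 : (1 - c) * q j ≤ c * ∑ k ∈ Finset.univ.erase j, componentRoot w ρ k x ^ 2 := by
      change q j ≤ c * (q j + _) at h4
      linarith
    calc (1 - c) * (w j * q j ^ 2) = w j * q j * ((1 - c) * q j) := by ring
      _ ≤ w j * q j * (c * ∑ k ∈ Finset.univ.erase j, componentRoot w ρ k x ^ 2) := by gcongr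
      _ = _ := by ring
  rcases le_total c 1 with hc1 | hc1
  · nlinarith
  · have := mul_nonneg (h.pointOverlap_nonneg x) hc.le
    linarith

theorem integrable_pointOverlap_and_integral_le (h : IsMixtureModel m M w ρ)
    (hM : MeasurableSet M) :
    Integrable (pointOverlap w ρ) (weightedVol m M (mixtureDensity w ρ)) ∧
    ∫ x, pointOverlap w ρ x ∂weightedVol m M (mixtureDensity w ρ) ≤ N * overlap m M w ρ := by
  have hint : ∀ j k, Integrable
      (fun x => componentRoot w ρ j x ^ 2 * componentRoot w ρ k x ^ 2)
      (weightedVol m M (mixtureDensity w ρ)) := fun j k =>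
    (h.memLp_componentRoot_sq hM j).integrable_mul (h.memLp_componentRoot_sq hM k)
  have hint' : ∀ j, Integrable (fun x => w j * ∑ k ∈ Finset.univ.erase j,
      componentRoot w ρ j x ^ 2 * componentRoot w ρ k x ^ 2)
      (weightedVol m M (mixtureDensity w ρ)) := fun j =>
    (integrable_finsetSum _ fun k _ => hint j k).const_mul (w j)
  refine ⟨integrable_finsetSum _ fun j _ => hint' j, ?_⟩
  simp only [pointOverlap]
  rw [integral_finsetSum _ fun j _ => hint' j]
  have hS := h.overlap_nonneg hM
  calc _ ≤ ∑ j, w j * (N * overlap m M w ρ) := by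
        refine Finset.sum_le_sum fun j _ => ?_
        rw [integral_const_mul, integral_finsetSum _ fun k _ => hint j k]
        refine mul_le_mul_of_nonneg_left ?_ (h.weight_pos j).le
        refine (Finset.sum_le_sum fun k hk => h.integral_componentRoot_sq_mul_sq_le hM
          (Finset.ne_of_mem_erase hk).symm).trans ?_
        rw [Finset.sum_const, nsmul_eq_mul]
        refine mul_le_mul_of_nonneg_right ?_ hS
        exact_mod_cast (Finset.card_le_univ _).trans (by simp)
    _ = _ := by rw [← Finset.sum_mul, h.weight_sum, one_mul]

/-- Pointwise form of the conclusion: where the overlap is small and the embedding `F` is close to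
the rotated ideal embedding `∑ q_k b_k`, it lies in one of the cones around the axes `b_k`. -/
theorem exists_mem_coneSet (h : IsMixtureModel m M w ρ) [Nonempty (Fin N)]
    {x : EuclideanSpace ℝ (Fin d)} (hx : x ∈ M) {σ s : ℝ} (hσ : 0 < σ) (hs : 0 < s)
    (hsσ : s + σ < Real.pi / 4)
    (b : OrthonormalBasis (Fin N) ℝ (EuclideanSpace ℝ (Fin N))) (z : EuclideanSpace ℝ (Fin N))
    (hlt : pointOverlap w ρ x < (1 - Real.cos σ ^ 2) / Real.cos σ ^ 2)
    (hz : ∑ k, (componentRoot w ρ k x - inner ℝ (b k) z) ^ 2 < Real.sin s ^ 2 / wMax w) :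
    ∃ j, z ∈ coneSet (b j) (σ + s) ((1 - Real.sin s) / √(wMax w)) := by
  have hpi := Real.pi_pos
  have hwM : 0 < wMax w := (h.wMin_pos).trans_le
    ((wMin_le w (Classical.arbitrary _)).trans (le_wMax w _))
  have hcos : 0 < Real.cos σ := Real.cos_pos_of_mem_Ioo ⟨by linarith, by linarith⟩
  have hsin : 0 < Real.sin s := Real.sin_pos_of_pos_of_lt_pi hs (by linarith)
  obtain ⟨j, hj⟩ := h.exists_mul_sum_lt_componentRoot_sq hx (by positivity) hlt
  set q : EuclideanSpace ℝ (Fin N) := ∑ k, componentRoot w ρ k x • b k with hq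
  have hbq : ∀ k, inner ℝ (b k) q = componentRoot w ρ k x := fun k =>
    b.orthonormal.inner_right_fintype _ k
  have hqn : ‖q‖ ^ 2 = ∑ k, componentRoot w ρ k x ^ 2 := by
    rw [← b.sum_sq_inner_right q]
    simp_rw [hbq]
  have hzq : ‖z - q‖ ^ 2 < Real.sin s ^ 2 / wMax w := by
    rw [norm_sub_rev, ← b.sum_sq_inner_right]
    simp_rw [inner_sub_right, hbq]
    exact hz
  have hr : (√(wMax w))⁻¹ ≤ ‖q‖ := by
    rw [← Real.sqrt_inv]
    refine (Real.sqrt_le_left (norm_nonneg _)).2 ?_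
    rw [hqn, ← one_div, div_le_iff₀' hwM, ← h.sum_mul_componentRoot_sq hx, Finset.mul_sum]
    exact Finset.sum_le_sum fun k _ => mul_le_mul_of_nonneg_right (le_wMax w k) (sq_nonneg _)
  have hzq' : ‖z - q‖ < Real.sin s * (√(wMax w))⁻¹ := by
    refine lt_of_pow_lt_pow_left₀ 2 (by positivity) ?_
    rwa [mul_pow, inv_pow, Real.sq_sqrt hwM.le, ← div_eq_mul_inv]
  refine ⟨j, ?_, ?_⟩
  · refine cos_add_lt_inner_div_norm (b.norm_eq_one j) hσ.le hs.le (by linarith) ?_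
      (hzq'.trans_le ?_)
    · rw [real_inner_comm, hbq]
      refine lt_of_pow_lt_pow_left₀ 2 (componentRoot_nonneg w ρ j x) ?_
      rwa [mul_pow, hqn]
    · rw [mul_comm]
      exact mul_le_mul_of_nonneg_right hr hsin.le
  · have h1 := norm_sub_norm_le q z
    rw [norm_sub_rev] at h1
    rw [sub_div, one_div, div_eq_mul_inv]
    linarith

end IsMixtureModel

/-! ### The size of the parameters -/

theorem natCast_mul_overlap_lt_one {n wm wM S σ : ℝ} (hn : 1 ≤ n) (hwm : 0 < wm) (hw : wm ≤ wM)
    (hS0 : 0 ≤ S) (hσ : σ ∈ Set.Ioo 0 (Real.pi / 4))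
    (hS : S < wm * (1 - Real.cos σ ^ 2) / (wM * Real.cos σ ^ 2 * n ^ 2)) : n * S < 1 := by
  have hpi := Real.pi_pos
  have hc : √2 / 2 < Real.cos σ := by
    rw [← Real.cos_pi_div_four]
    exact Real.cos_lt_cos_of_nonneg_of_le_pi hσ.1.le (by linarith) hσ.2
  have hc2 : 1 / 2 < Real.cos σ ^ 2 := by
    have h1 := Real.sq_sqrt (show (0 : ℝ) ≤ 2 by norm_num)
    have h2 := Real.sqrt_nonneg 2
    nlinarith
  have hwM : 0 < wM := hwm.trans_le hw
  rw [lt_div_iff₀ (by positivity)] at hS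
  have h1 : wm * (1 - Real.cos σ ^ 2) ≤ wM * Real.cos σ ^ 2 := by
    have := Real.cos_sq_le_one σ
    exact mul_le_mul hw (by linarith) (by linarith) hwM.le
  have h2 : S * n ^ 2 * (wM * Real.cos σ ^ 2) < 1 * (wM * Real.cos σ ^ 2) := by
    rw [one_mul]; refine lt_of_eq_of_lt ?_ (hS.trans_le h1); ring
  have h3 : S * n ^ 2 < 1 := lt_of_mul_lt_mul_right h2 (by positivity)
  nlinarith [mul_nonneg hS0 (mul_nonneg (by linarith : (0 : ℝ) ≤ n) (by linarith : 0 ≤ n - 1))]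

/-- Positivity of `(√(Θ (1 - n S) / C) - √(n S) / (1 - S))⁻¹` excludes the degenerate values of `Θ`
and `C`, and then this number bounds `√(C / Θ)`. -/
theorem sqrt_div_le_of_inv_pos {n S Θ C : ℝ} (hn : 1 ≤ n) (hS : 0 ≤ S) (hnS : n * S < 1)
    (hC : 0 ≤ C) (hpos : 0 < (√(Θ * (1 - n * S) / C) - √(n * S) / (1 - S))⁻¹) :
    0 < Θ ∧ 0 < C ∧ √(C / Θ) ≤ (√(Θ * (1 - n * S) / C) - √(n * S) / (1 - S))⁻¹ := by
  have hb : 0 ≤ √(n * S) / (1 - S) := div_nonneg (Real.sqrt_nonneg _) (by nlinarith)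
  have hsub := inv_pos.1 hpos
  have ha : 0 < Θ * (1 - n * S) / C := Real.sqrt_pos.1 (by linarith)
  have hC0 : 0 < C := hC.lt_of_ne fun h => by rw [← h, div_zero] at ha; exact lt_irrefl _ ha
  have hΘ : 0 < Θ := by
    have := (div_pos_iff_of_pos_right hC0).1 ha
    exact (mul_pos_iff_of_pos_right (by linarith)).1 this
  refine ⟨hΘ, hC0, ?_⟩
  rw [← inv_div, Real.sqrt_inv]
  refine inv_anti₀ hsub ?_
  have h1 : √(Θ * (1 - n * S) / C) ≤ √(Θ / C) := by
    refine Real.sqrt_le_sqrt (div_le_div_of_nonneg_right ?_ hC0.le)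
    nlinarith [mul_nonneg (by linarith : (0 : ℝ) ≤ n) hS]
  linarith

/-- Almost orthonormality and projection errors of size `η` put the two embeddings at a squared
distance of at most `n η² + (n (R + η²))²`; this is well below `n` times the quantity assumed to be
at most `t² sin² s / (n w_max)`. -/
theorem distance_bound_le {n η R τ : ℝ} (hn : 1 ≤ n) (hη : 0 < η) (hR : 0 ≤ R)
    (hτ : τ = 4 * η + R) (hτn : τ * n < 1) :
    n * (R + η ^ 2) < 1 ∧
    n * η ^ 2 + (n * (R + η ^ 2)) ^ 2 ≤
      n * (n * ((τ - R) / 2) ^ 2 + 4 * n ^ (3 / 2 : ℝ) * (1 / √(1 - n * τ) - 1)) := by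
  have hτ1 : τ < 1 := by nlinarith
  have hη2 : η ^ 2 ≤ 4 * η := by nlinarith
  have h1 : n * (R + η ^ 2) ≤ n * τ := mul_le_mul_of_nonneg_left (by linarith) (by linarith)
  have h0 : 0 ≤ n * (R + η ^ 2) := by positivity
  refine ⟨by linarith, ?_⟩
  set a := n * τ with ha
  have ha0 : 0 ≤ a := h0.trans h1
  have ha1 : a < 1 := by rw [ha]; linarith
  have h2 : a / 2 ≤ 1 / √(1 - a) - 1 := by
    have h3 : 0 < √(1 - a) := Real.sqrt_pos.2 (by linarith)
    have h4 : √(1 - a) ≤ 1 - a / 2 := by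
      rw [Real.sqrt_le_left (by linarith)]; nlinarith
    rw [le_sub_iff_add_le, le_div_iff₀ h3]
    nlinarith
  have h5 : (1 : ℝ) ≤ n ^ (3 / 2 : ℝ) := Real.one_le_rpow hn (by norm_num)
  have h6 : a / 2 ≤ n ^ (3 / 2 : ℝ) * (1 / √(1 - a) - 1) := by nlinarith
  have h7 : (n * (R + η ^ 2)) ^ 2 ≤ a := by nlinarith
  have h8 : (τ - R) / 2 = 2 * η := by rw [hτ]; ring
  rw [h8]
  have h9 : n * η ^ 2 ≤ n * (n * (2 * η) ^ 2) := by
    have : 0 ≤ η ^ 2 := sq_nonneg _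
    refine mul_le_mul_of_nonneg_left ?_ (by linarith)
    nlinarith
  have h10 : a ≤ n * (4 * n ^ (3 / 2 : ℝ) * (1 / √(1 - a) - 1)) := by nlinarith
  linarith [mul_add n (n * (2 * η) ^ 2) (4 * n ^ (3 / 2 : ℝ) * (1 / √(1 - a) - 1))]

end Cones

/-! ### The Laplacian embedding -/

theorem mainTheorem1 {d m N : ℕ} (M : Set (EuclideanSpace ℝ (Fin d)))
    (hM : IsEmbeddedSubmanifold m M) (hconn : IsConnected M)
    (w : Fin N → ℝ) (ρ : Fin N → EuclideanSpace ℝ (Fin d) → ℝ)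
    (hmix : IsMixtureModel m M w ρ)
    (hspec : HasDiscreteSpectrum m M (mixtureDensity w ρ))
    (hspec' : ∀ k, HasDiscreteSpectrum m M (ρ k))
    (u : Fin N → EuclideanSpace ℝ (Fin d) → ℝ)
    (hu : IsFirstEigenfunctions m M (mixtureDensity w ρ) u)
    (σ : ℝ) (hσ : σ ∈ Set.Ioo 0 (Real.pi / 4))
    (hS : overlap m M w ρ <
      wMin w * (1 - Real.cos σ ^ 2) / (wMax w * Real.cos σ ^ 2 * (N : ℝ) ^ 2))
    (hτ : 0 < tauParam m M w ρ - √(overlap m M w ρ))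
    (hτN : tauParam m M w ρ * N < 1)
    (s t : ℝ) (hs : 0 < s) (ht : 0 < t)
    (hst : (N : ℝ) * ((tauParam m M w ρ - √(overlap m M w ρ)) / 2) ^ 2 +
        4 * (N : ℝ) ^ (3 / 2 : ℝ) * (1 / √(1 - N * tauParam m M w ρ) - 1) ≤
      t ^ 2 * Real.sin s ^ 2 / (N * wMax w))
    (hsσ : s + σ < Real.pi / 4)
    (δ : ℝ) (hδ : δ ∈ Set.Ico (deltaStar m M w ρ σ) 1) :
    HasOrthogonalConeStructure
      (Measure.map (laplacianEmbedding u) (weightedVol m M (mixtureDensity w ρ)))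
      (σ + s) (δ + t ^ 2) ((1 - Real.sin s) / √(wMax w)) := by
  have hMm := hM.measurableSet
  have hpi := Real.pi_pos
  have hNe : Nonempty (Fin N) := by
    by_contra hN
    rw [not_nonempty_iff] at hN
    simpa using hmix.weight_sum
  have hN1 : (1 : ℝ) ≤ N := by
    have := Fintype.card_pos (α := Fin N)
    rw [Fintype.card_fin] at this
    exact_mod_cast this
  have := hmix.isProbabilityMeasure_mixture hMm
  set ν := weightedVol m M (mixtureDensity w ρ)
  set S := overlap m M w ρ with hSdef
  have hS0 : 0 ≤ S := hmix.overlap_nonneg hMm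
  have hwm := hmix.wMin_pos
  have hww : wMin w ≤ wMax w := (wMin_le w (Classical.arbitrary _)).trans (le_wMax w _)
  have hwM : 0 < wMax w := hwm.trans_le hww
  have hNS := natCast_mul_overlap_lt_one hN1 hwm hww hS0 hσ hS
  have hsin : 0 < Real.sin s := Real.sin_pos_of_pos_of_lt_pi hs (by linarith [hσ.1])
  have hcos : 0 < Real.cos σ := Real.cos_pos_of_mem_Ioo ⟨by linarith [hσ.1], by linarith [hσ.2]⟩
  have hsinσ : 0 < 1 - Real.cos σ ^ 2 := by
    have h1 := Real.sin_sq_add_cos_sq σ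
    have h2 := Real.sin_pos_of_pos_of_lt_pi hσ.1 (by linarith [hσ.2])
    nlinarith
  set η := (√(indivisibility m M ρ * (1 - N * S) / (coupling m M w ρ).toReal) -
      √(N * S) / (1 - S))⁻¹
  have hτη : tauParam m M w ρ = 4 * η + √S := rfl
  have hη : 0 < η := by rw [hτη] at hτ; linarith
  obtain ⟨hΘ, hC, hηle⟩ := sqrt_div_le_of_inv_pos hN1 hS0 hNS ENNReal.toReal_nonneg hη
  have hCtop : coupling m M w ρ ≠ ⊤ := fun h => by rw [h] at hC; simp at hC
  obtain ⟨hlt, hdist⟩ := distance_bound_le hN1 hη (Real.sqrt_nonneg S) hτη hτN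
  obtain ⟨e, lam, he, hue⟩ := hu
  have horth : Orthonormal ℝ fun i : Fin N => e i := e.orthonormal.comp _ Fin.val_injective
  obtain ⟨b, hb⟩ := exists_orthonormalBasis_near horth (Real.sqrt_nonneg S)
    (fun k => hmix.norm_toLp_componentRoot hMm k)
    (fun k l hkl => hmix.abs_inner_componentRoot_le hMm hkl)
    (fun k => pow_le_pow_left₀ (norm_nonneg _)
      ((hmix.norm_componentRoot_sub_le hM he hΘ hCtop k).trans hηle) 2) hlt
  -- The `L²` distance between the embedding and the rotated ideal embedding.
  set g : EuclideanSpace ℝ (Fin d) → ℝ := fun x =>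
    ∑ k, (componentRoot w ρ k x - inner ℝ (b k) (laplacianEmbedding u x)) ^ 2 with hg
  have hu2 : ∀ i, MemLp (u i) 2 ν := fun i => (Lp.memLp (e i)).ae_eq (hue i).symm
  have hinner : ∀ k x, inner ℝ (b k) (laplacianEmbedding u x) = ∑ i, b k i * u i x := fun k x => by
    simp [laplacianEmbedding, PiLp.inner_apply, mul_comm]
  have hgk : ∀ k, MemLp (fun x => componentRoot w ρ k x -
      inner ℝ (b k) (laplacianEmbedding u x)) 2 ν := fun k => by
    simp_rw [hinner]
    exact (hmix.memLp_componentRoot hMm k).sub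
      (memLp_finsetSum _ fun i _ => (hu2 i).const_mul (b k i))
  have hgint : Integrable g ν := integrable_finsetSum _ fun k _ => (hgk k).integrable_sq
  have hgle : ∫ x, g x ∂ν ≤ t ^ 2 * (Real.sin s ^ 2 / wMax w) := by
    have h1 : ∫ x, g x ∂ν = ∑ k, ‖(hmix.memLp_componentRoot hMm k).toLp _ -
        ∑ i : Fin N, b k i • e i‖ ^ 2 := by
      rw [hg, integral_finsetSum _ fun k _ => (hgk k).integrable_sq]
      refine Finset.sum_congr rfl fun k _ => ?_
      have h2 := (hgk k).norm_toLp_sq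
      simp only [Real.norm_eq_abs, sq_abs] at h2
      rw [← h2]
      congr 2
      have h3 : MemLp (fun x => ∑ i, b k i • u i x) 2 ν :=
        memLp_finsetSum _ fun i _ => (hu2 i).const_mul (b k i)
      have h4 : ∀ i, (hu2 i).toLp (u i) = e i := fun i => by
        rw [← Lp.toLp_coeFn (e i) (Lp.memLp (e i))]
        exact MemLp.toLp_congr _ _ (hue i)
      simp_rw [← h4]
      rw [← MemLp.toLp_finset_sum_smul Finset.univ _ hu2 h3, ← MemLp.toLp_sub]
      refine MemLp.toLp_congr _ _ (ae_of_all _ fun x => ?_)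
      simp [hinner]
    rw [h1]
    refine (hb.trans hdist).trans ?_
    refine (mul_le_mul_of_nonneg_left hst (by linarith)).trans (le_of_eq ?_)
    field_simp
  -- The two exceptional sets, estimated by Markov's inequality.
  set B₁ := {x | (1 - Real.cos σ ^ 2) / Real.cos σ ^ 2 ≤ pointOverlap w ρ x}
  set B₂ := {x | Real.sin s ^ 2 / wMax w ≤ g x}
  have hδ0 : 0 ≤ deltaStar m M w ρ σ := by
    rw [deltaStar, ← hSdef]
    positivity
  have hB₁ : ν.real B₁ ≤ δ := by
    obtain ⟨h1, h2⟩ := hmix.integrable_pointOverlap_and_integral_le hMm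
    have h3 := mul_meas_ge_le_integral_of_nonneg (ae_of_all _ hmix.pointOverlap_nonneg) h1
      ((1 - Real.cos σ ^ 2) / Real.cos σ ^ 2)
    refine le_trans ?_ hδ.1
    have h4 := h3.trans h2
    rw [← le_div_iff₀' (by positivity)] at h4
    refine h4.trans ?_
    rw [deltaStar, ← hSdef, div_div_eq_mul_div,
      div_le_div_iff₀ hsinσ (by positivity)]
    have h5 : wMin w * (N * S) ≤ wMax w * (N ^ 2 * S) := by
      refine mul_le_mul hww ?_ (by positivity) hwM.le
      nlinarith [mul_nonneg hS0 (mul_nonneg (by linarith : (0 : ℝ) ≤ N)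
        (by linarith : (0 : ℝ) ≤ N - 1))]
    have h6 := mul_le_mul_of_nonneg_right h5
      (by positivity : 0 ≤ Real.cos σ ^ 2 * (1 - Real.cos σ ^ 2))
    linarith
  have hB₂ : ν.real B₂ ≤ t ^ 2 := by
    have h3 := (mul_meas_ge_le_integral_of_nonneg (ae_of_all _ fun x =>
      Finset.sum_nonneg fun k _ => sq_nonneg _) hgint (Real.sin s ^ 2 / wMax w)).trans hgle
    rw [mul_comm] at h3
    exact le_of_mul_le_mul_right h3 (by positivity)
  have hFm : AEMeasurable (laplacianEmbedding u) ν := by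
    refine (WithLp.measurable_toLp 2 (Fin N → ℝ)).comp_aemeasurable ?_
    exact aemeasurable_pi_lambda _ fun i => (hu2 i).1.aemeasurable
  refine ⟨Measure.isProbabilityMeasure_map hFm, by linarith [hσ.1], by linarith,
    by linarith [hδ.1, sq_nonneg t], ?_, b, ?_⟩
  · refine div_pos ?_ (Real.sqrt_pos.2 hwM)
    have h1 := Real.sin_lt_sin_of_lt_of_le_pi_div_two (x := s) (y := Real.pi / 2)
      (by linarith) le_rfl (by linarith [hσ.1])
    rw [Real.sin_pi_div_two] at h1
    linarith
  · refine le_trans ?_ (Measure.le_map_apply hFm _)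
    set A := laplacianEmbedding u ⁻¹'
      ⋃ j, coneSet (b j) (σ + s) ((1 - Real.sin s) / √(wMax w))
    have hcov : ∀ᵐ x ∂ν, x ∈ A ∪ (B₁ ∪ B₂) := by
      filter_upwards [ae_mem_weightedVol hMm _] with x hx
      by_contra hcon
      simp only [mem_union, not_or] at hcon
      obtain ⟨hA, h1, h2⟩ := hcon
      exact hA (mem_iUnion.2 (hmix.exists_mem_coneSet hx hσ.1 hs hsσ b _ (not_le.1 h1)
        (not_le.1 h2)))
    rw [ENNReal.ofReal_le_iff_le_toReal (measure_ne_top ν A)]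
    have h1 : ν.real (A ∪ (B₁ ∪ B₂)) = 1 := by
      have h2 : (A ∪ (B₁ ∪ B₂) : Set _) =ᵐ[ν] univ := eventuallyEq_univ.2 hcov
      rw [measureReal_congr h2, probReal_univ]
    have h2 := measureReal_union_le (μ := ν) A (B₁ ∪ B₂)
    have h3 := measureReal_union_le (μ := ν) B₁ B₂
    change 1 - (δ + t ^ 2) ≤ ν.real A
    linarith
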